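/- **Setting.** Let $M \ge 2$, let $F$ be a connected compact metric space and let $\psi_1,\dots,\psi_M : F \to F$ be injective strict contractions with $F = \bigcup_{i=1}^M \psi_i(F)$. For a finite word $w = w_1\cdots w_n$ in the alphabet $I = \{1,\dots,M\}$ put $\psi_w = \psi_{w_1}\circ\cdots\circ\psi_{w_n}$, and let $\pi : I^{\mathbb N} \to F$ be given by $\{\pi(\omega)\} = \bigcap_{n} \psi_{\omega_1\cdots\omega_n}(F)$. Assume that $(F,(\psi_i))$ is post-critically finite: the set $P = \bigcup_{n\ge 1}\sigma^n\big(\pi^{-1}(\bigcup_{i\ne j}\psi_i(F)\cap\psi_j(F))\big)$ is finite, where $\sigma$ is the left shift. Let $F^0 = \pi(P)$. Let $(A_0,\mathbf r)$ be a regular irreducible harmonic structure: $\mathbf r = (r_1,\dots,r_M)$ with $0<r_i<1$, and $A_0$ is a symmetric non-positive definite real matrix indexed by $F^0$ whose off-diagonal entries are non-negative and whose kernel consists exactly of the constant functions, such that, with $$\mathcal E_0(u,u) = -u^{T} A_0 u,\qquad \mathcal E_n(f,f) = \sum_{w\in I^n} \frac{1}{r_{w_1}\cdots r_{w_n}}\,\mathcal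 E_0\big(f\circ\psi_w|_{F^0},f\circ\psi_w|_{F^0}\big),$$ one has $\mathcal E_0(u,u) = \min\{\mathcal E_1(v,v) : v|_{F^0} = u\}$ for every $u : F^0\to\mathbb R$. Let $d_H>0$ be the unique number with $\sum_{i} r_i^{d_H} = 1$. For $f\in C(F)$ let $\mathcal E(f,f) = \sup_n \mathcal E_n(f,f) = \lim_n\mathcal E_n(f,f)\in[0,\infty]$, let $\mathcal D = \{f\in C(F) : \mathcal E(f,f)<\infty\}$, and let $R$ be the resistance metric on $F$, $$R(x,y) = \big(\inf\{\mathcal E(f,f) : f\in\mathcal D,\ f(x)=0,\ f(y)=1\}\big)^{-1}$$ (so $R(x,x) = 0$). **Theorem (First continuity theorem).** Let $(E,\Delta)$ be a complete separable metric space, let $\xi = (\xi_x)_{x\in F}$ be a family of $E$-valued random variables on a probability space, and let $C,\beta,\gamma>0$ be such that $$\mathbb E\big[\Delta(\xi_x,\xi_y)^\beta\big] \le C\,R(x,y)^{d_H+\gamma}\qquad\text{for all } x,y\in F.$$ Then $\xi$ has a version (a family $(\eta_x)_{x\in F}$ of $E$-valued random variables on the same probability space with $\eta_x = \xi_x$ almost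 surely for each $x\in F$) which is almost surely essentially $\frac{\gamma}{\beta}$-Hölder continuous with respect to $R$: for almost every $\omega$ and every $\theta\in(0,\frac\gamma\beta)$ there is a finite constant $K$, depending on $\omega$ and $\theta$, such that $\Delta(\eta_x(\omega),\eta_y(\omega)) \le K\,R(x,y)^\theta$ for all $x,y\in F$. -/

import Mathlib

open MeasureTheory Set
open scoped ENNReal NNReal Matrix

namespace PCF

/-- A self-similar set: a compact connected metric space `F` (non-empty, as `ConnectedSpace`
says) which is the union of its images under `M ≥ 2` injective strict contractions. -/
structure SelfSimilarSet (F : Type*) [MetricSpace F] [CompactSpace F] [ConnectedSpace F]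
    (M : ℕ) where
  two_le : 2 ≤ M
  ψ : Fin M → F → F
  injective : ∀ i, Function.Injective (ψ i)
  contracting : ∀ i, ∃ K : ℝ≥0, ContractingWith K (ψ i)
  iUnion_range : ⋃ i, range (ψ i) = univ

namespace SelfSimilarSet

variable {F : Type*} [MetricSpace F] [CompactSpace F] [ConnectedSpace F] {M : ℕ}

/-- `ψ_w = ψ_{w₁} ∘ ⋯ ∘ ψ_{wₙ}` for a finite word `w`. -/
def wordMap (S : SelfSimilarSet F M) : List (Fin M) → F → F
  | [] => id
  | i :: w => S.ψ i ∘ wordMap S w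

/-- The cell `F_w = ψ_w(F)`. -/
def cell (S : SelfSimilarSet F M) (w : List (Fin M)) : Set F := range (S.wordMap w)

/-- The word made of the first `n` letters of the infinite word `ω`. -/
def pre (ω : ℕ → Fin M) (n : ℕ) : List (Fin M) := List.ofFn fun i : Fin n => ω i

theorem wordMap_append (S : SelfSimilarSet F M) (v w : List (Fin M)) :
    S.wordMap (v ++ w) = S.wordMap v ∘ S.wordMap w := by
  induction v with
  | nil => rfl
  | cons i v ih => simp [wordMap, ih, Function.comp_assoc]

theorem pre_succ (ω : ℕ → Fin M) (n : ℕ) : pre ω (n + 1) = pre ω n ++ [ω n] := by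
  rw [pre, List.ofFn_succ_last]
  simp [pre]

theorem exists_lipschitz (S : SelfSimilarSet F M) :
    ∃ K : ℝ≥0, K < 1 ∧ ∀ w : List (Fin M), LipschitzWith (K ^ w.length) (S.wordMap w) := by
  choose K hK using S.contracting
  refine ⟨Finset.univ.sup K, ?_, fun w => ?_⟩
  · exact (Finset.sup_lt_iff (by simp)).2 fun i _ => (hK i).1
  · induction w with
    | nil => simpa [wordMap] using LipschitzWith.id
    | cons i w ih =>
      have h := ((hK i).2.weaken (Finset.le_sup (f := K) (Finset.mem_univ i))).comp ih
      rw [List.length_cons, pow_succ']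
      exact h

/-- The cells along an infinite word shrink to exactly one point. -/
theorem existsUnique_code (S : SelfSimilarSet F M) (ω : ℕ → Fin M) :
    ∃! x : F, ∀ n, x ∈ S.cell (pre ω n) := by
  obtain ⟨K, hK, hL⟩ := S.exists_lipschitz
  have hcpt : ∀ n, IsCompact (S.cell (pre ω n)) := fun n =>
    isCompact_range (hL _).continuous
  obtain ⟨x, hx⟩ := IsCompact.nonempty_iInter_of_sequence_nonempty_isCompact_isClosed
    (fun n => S.cell (pre ω n))
    (fun n => by
      rintro _ ⟨y, rfl⟩
      refine ⟨S.ψ (ω n) y, ?_⟩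
      simp [pre_succ, wordMap_append, wordMap])
    (fun n => range_nonempty _) (hcpt 0) (fun n => (hcpt n).isClosed)
  refine ⟨x, fun n => mem_iInter.1 hx n, fun y hy => ?_⟩
  have hdist : ∀ n : ℕ, dist y x ≤ (K : ℝ) ^ n * Metric.diam (univ : Set F) := fun n => by
    obtain ⟨a, ha⟩ := hy n
    obtain ⟨b, hb⟩ := mem_iInter.1 hx n
    have h := (hL (pre ω n)).dist_le_mul a b
    rw [ha, hb] at h
    have hab : dist a b ≤ Metric.diam (univ : Set F) :=
      Metric.dist_le_diam_of_mem isCompact_univ.isBounded (mem_univ a) (mem_univ b)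
    have hlen : (pre ω n).length = n := by simp [pre]
    rw [hlen] at h
    push_cast at h
    exact h.trans (mul_le_mul_of_nonneg_left hab (by positivity))
  have hlim : Filter.Tendsto (fun n : ℕ => (K : ℝ) ^ n * Metric.diam (univ : Set F))
      Filter.atTop (nhds 0) := by
    simpa using (tendsto_pow_atTop_nhds_zero_of_lt_one K.2 (by exact_mod_cast hK)).mul_const
      (Metric.diam (univ : Set F))
  exact dist_le_zero.1 (ge_of_tendsto' hlim hdist)

/-- The canonical surjection `π` from infinite words to `F`: `{π ω} = ⋂ₙ F_{ω₁…ωₙ}`. -/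
noncomputable def code (S : SelfSimilarSet F M) (ω : ℕ → Fin M) : F :=
  (S.existsUnique_code ω).choose

/-- The critical set `π⁻¹(⋃_{i ≠ j} F_i ∩ F_j)`. -/
def criticalSet (S : SelfSimilarSet F M) : Set (ℕ → Fin M) :=
  {ω | ∃ i j, i ≠ j ∧ S.code ω ∈ range (S.ψ i) ∩ range (S.ψ j)}

/-- The post-critical set `P = ⋃_{n ≥ 1} σⁿ(criticalSet)`, where `σ` is the left shift. -/
def postCriticalSet (S : SelfSimilarSet F M) : Set (ℕ → Fin M) :=
  {ω | ∃ n, 1 ≤ n ∧ ∃ τ ∈ S.criticalSet, ω = fun k => τ (k + n)}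

end SelfSimilarSet

/-- A connected post-critically finite self-similar set. -/
structure PCFSelfSimilarSet (F : Type*) [MetricSpace F] [CompactSpace F] [ConnectedSpace F]
    (M : ℕ) extends SelfSimilarSet F M where
  finite_postCriticalSet : toSelfSimilarSet.postCriticalSet.Finite

/-- Laplacians on a finite set `V`: symmetric non-positive definite matrices whose kernel
is the constants (this is the irreducibility) and whose off-diagonal entries are non-negative. -/
structure IsLaplacian {V : Type*} [Fintype V] (A : Matrix V V ℝ) : Prop where
  symm : A.IsSymm
  nonpos : ∀ u : V → ℝ, u ⬝ᵥ (A *ᵥ u) ≤ 0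
  ker : ∀ u : V → ℝ, A *ᵥ u = 0 ↔ ∃ c : ℝ, u = fun _ => c
  offDiag : ∀ p q, p ≠ q → 0 ≤ A p q

namespace PCFSelfSimilarSet

variable {F : Type*} [MetricSpace F] [CompactSpace F] [ConnectedSpace F] {M : ℕ}

/-- The boundary `F⁰ = π(P)`. -/
def boundary (S : PCFSelfSimilarSet F M) : Set F := S.code '' S.postCriticalSet

noncomputable instance (S : PCFSelfSimilarSet F M) : Fintype S.boundary :=
  (S.finite_postCriticalSet.image S.code).fintype

/-- The quadratic form `𝓔₀(u,u) = -uᵀ A u` on functions on the boundary. -/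
noncomputable def boundaryEnergy (S : PCFSelfSimilarSet F M)
    (A : Matrix S.boundary S.boundary ℝ) (u : S.boundary → ℝ) : ℝ :=
  -(u ⬝ᵥ (A *ᵥ u))

/-- The level-`n` quadratic form `𝓔ₙ(f,f) = ∑_{|w| = n} r_w⁻¹ 𝓔₀(f ∘ ψ_w, f ∘ ψ_w)`. It depends
only on the values of `f` on `Fⁿ = ⋃_{|w| = n} ψ_w(F⁰)`. -/
noncomputable def levelEnergy (S : PCFSelfSimilarSet F M)
    (A : Matrix S.boundary S.boundary ℝ) (r : Fin M → ℝ) (n : ℕ) (f : F → ℝ) : ℝ :=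
  ∑ w : Fin n → Fin M, (∏ k, r (w k))⁻¹ *
    S.boundaryEnergy A fun p => f (S.wordMap (List.ofFn w) p)

end PCFSelfSimilarSet

/-- A regular irreducible harmonic structure `(A₀, r)`: a Laplacian on `F⁰` and weights in `(0,1)`
such that `𝓔₀(u,u) = min {𝓔₁(v,v) : v = u on F⁰}` for every `u` on `F⁰`. -/
structure RegularHarmonicStructure {F : Type*} [MetricSpace F] [CompactSpace F]
    [ConnectedSpace F] {M : ℕ} (S : PCFSelfSimilarSet F M) where
  A : Matrix S.boundary S.boundary ℝ
  r : Fin M → ℝ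
  isLaplacian : IsLaplacian A
  r_pos : ∀ i, 0 < r i
  r_lt_one : ∀ i, r i < 1
  compatible : ∀ u : S.boundary → ℝ,
    IsLeast {e : ℝ | ∃ v : F → ℝ, (∀ p : S.boundary, v p = u p) ∧ e = S.levelEnergy A r 1 v}
      (S.boundaryEnergy A u)

namespace RegularHarmonicStructure

variable {F : Type*} [MetricSpace F] [CompactSpace F] [ConnectedSpace F] {M : ℕ}
  {S : PCFSelfSimilarSet F M}

theorem existsUnique_dim (H : RegularHarmonicStructure S) :
    ∃! d : ℝ, 0 < d ∧ ∑ i, H.r i ^ d = 1 := by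
  have hM : (2 : ℝ) ≤ M := by exact_mod_cast S.two_le
  have : Nonempty (Fin M) := ⟨⟨0, by have := S.two_le; omega⟩⟩
  have hanti : StrictAnti fun d : ℝ => ∑ i, H.r i ^ d := fun a b hab =>
    Finset.sum_lt_sum_of_nonempty Finset.univ_nonempty fun i _ =>
      Real.rpow_lt_rpow_of_exponent_gt (H.r_pos i) (H.r_lt_one i) hab
  have hcont : Continuous fun d : ℝ => ∑ i, H.r i ^ d :=
    continuous_finsetSum _ fun i _ => Real.continuous_const_rpow (H.r_pos i).ne'
  have hlim : Filter.Tendsto (fun d : ℝ => ∑ i, H.r i ^ d) Filter.atTop (nhds 0) := by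
    simpa using tendsto_finsetSum Finset.univ fun i _ =>
      tendsto_rpow_atTop_of_base_lt_one (H.r i) (by linarith [H.r_pos i]) (H.r_lt_one i)
  obtain ⟨b, hb, hb0⟩ := ((hlim.eventually (gt_mem_nhds (zero_lt_one' ℝ))).and
    (Filter.eventually_ge_atTop 0)).exists
  obtain ⟨d, hd, hd1⟩ := intermediate_value_Icc' hb0 hcont.continuousOn
    (show (1 : ℝ) ∈ Icc _ _ from ⟨hb.le, by simpa using (by linarith : (1 : ℝ) ≤ M)⟩)
  refine ⟨d, ⟨lt_of_le_of_ne hd.1 ?_, hd1⟩, fun e he => hanti.injective (he.2.trans hd1.symm)⟩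
  rintro rfl
  simp at hd1
  rw [hd1] at hM
  norm_num at hM

/-- The number `d_H > 0` with `∑ᵢ rᵢ ^ d_H = 1`. -/
noncomputable def dH (H : RegularHarmonicStructure S) : ℝ := H.existsUnique_dim.choose

/-- The energy `𝓔(f,f)` of a continuous function, as the supremum (which is the limit) of the
non-decreasing sequence `𝓔ₙ(f,f)`; infinite when `f` is not in the domain. -/
noncomputable def energy (H : RegularHarmonicStructure S) (f : C(F, ℝ)) : ℝ≥0∞ :=
  ⨆ n : ℕ, ENNReal.ofReal (S.levelEnergy H.A H.r n f)

/-- The domain `𝓓` of the form: continuous functions of finite energy. -/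
def domain (H : RegularHarmonicStructure S) : Set C(F, ℝ) := {f | H.energy f < ∞}

/-- The resistance metric
`R(x,y) = (inf {𝓔(f,f) : f ∈ 𝓓, f(x) = 0, f(y) = 1})⁻¹`, with `R(x,x) = ∞⁻¹ = 0`. -/
noncomputable def resistance (H : RegularHarmonicStructure S) (x y : F) : ℝ≥0∞ :=
  (⨅ f ∈ {f : C(F, ℝ) | f ∈ H.domain ∧ f x = 0 ∧ f y = 1}, H.energy f)⁻¹

end RegularHarmonicStructure

/-- `f` is essentially `δ`-Hölder continuous with respect to the distance `d` on `X`: it is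
`θ`-Hölder continuous for every `θ ∈ (0, δ)` (hence continuous, if `δ > 0`). -/
def EssentiallyHolder {X E : Type*} [PseudoEMetricSpace E] (d : X → X → ℝ≥0∞) (δ : ℝ)
    (f : X → E) : Prop :=
  ∀ θ : ℝ, 0 < θ → θ < δ → ∃ K : ℝ≥0, ∀ x y, edist (f x) (f y) ≤ K * d x y ^ θ

end PCF

/-!
The square root of the resistance is `ρ(x, y) = sup {|f x - f y| : 𝓔(f, f) ≤ 1}`, visibly a
pseudometric. Since `𝓔(f ∘ ψᵢ, f ∘ ψᵢ) ≤ rᵢ 𝓔(f, f)`, each `ψᵢ` contracts it by the factor `√rᵢ`.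

It is bounded. On `F⁰` it is finite because the graph of the positive entries of `A₀` is connected;
as `F` is connected, the cells `ψᵢ(F)` are linked through points of `ψᵢ(F⁰)`, so all of
`⋃ᵢ ψᵢ(F⁰)`, which contains `F⁰`, is at finite distance from a point `p ∈ F⁰`; then a geometric
series bounds the distance from `p` on its orbit `{ψ_w(p)}`, and this bound passes to the closure
of the orbit, which is `F`, because `ρ(p, ·)` is a supremum of continuous functions.

A bounded space that is the union of its images under maps of Lipschitz constants `√rᵢ < 1` has
covering numbers `O(ε ^ (-2 d))`, where `∑ᵢ √rᵢ ^ (2 d) = 1`, that is, `d = d_H`. With respect to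
`ρ` the moment condition has the exponent `2 (d_H + γ)`, which exceeds `2 d_H`, so Kolmogorov's
chaining along nets of scale `2⁻ⁿ` yields a version that is Hölder in `ρ` of every order below
`2 γ / β`, that is, Hölder in the resistance of every order below `γ / β`.
-/

namespace KolmogorovChaining

open Filter Topology Metric ProbabilityTheory

section Deterministic

variable {T E : Type*} [PseudoEMetricSpace T] [PseudoEMetricSpace E] {u : ℕ → T → E} {D : ℝ≥0}
  {θ : ℝ}

/-- The approximations `u n : T → E`, seen at scale `D / 2 ^ n`, vary by at most a constant times
`2 ^ (-θ n)`, both from one level to the next and between points within that scale. This is what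
chaining needs to produce a `θ`-Hölder limit. -/
def HasGeometricChaining (u : ℕ → T → E) (D : ℝ≥0) (θ : ℝ) : Prop :=
  ∃ K : ℝ≥0, (∀ n t, edist (u n t) (u (n + 1) t) ≤ K * (2⁻¹ ^ θ) ^ n) ∧
    ∀ n s t, edist s t ≤ D * 2⁻¹ ^ n → edist (u n s) (u n t) ≤ K * (2⁻¹ ^ θ) ^ n

theorem inv_two_rpow_lt_one (hθ : 0 < θ) : (2⁻¹ : ℝ≥0∞) ^ θ < 1 :=
  ENNReal.rpow_lt_one (by simp) hθ

theorem HasGeometricChaining.mono (h : HasGeometricChaining u D θ) {θ' : ℝ} (hθ : θ' ≤ θ) :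
    HasGeometricChaining u D θ' := by
  obtain ⟨K, hstep, hlevel⟩ := h
  have hpow (n : ℕ) : (K : ℝ≥0∞) * (2⁻¹ ^ θ) ^ n ≤ K * (2⁻¹ ^ θ') ^ n := by
    gcongr 2
    exact ENNReal.rpow_le_rpow_of_exponent_ge (by simp) hθ
  exact ⟨K, fun n t => (hstep n t).trans (hpow n),
    fun n s t hst => (hlevel n s t hst).trans (hpow n)⟩

theorem HasGeometricChaining.exists_tendsto [CompleteSpace E] (h : HasGeometricChaining u D θ)
    (hθ : 0 < θ) (t : T) : ∃ y, Tendsto (fun n => u n t) atTop (𝓝 y) := by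
  obtain ⟨K, hstep, -⟩ := h
  exact cauchySeq_tendsto_of_complete <| cauchySeq_of_edist_le_geometric (2⁻¹ ^ θ) K
    (inv_two_rpow_lt_one hθ) ENNReal.coe_ne_top fun n => hstep n t

theorem HasGeometricChaining.exists_edist_le_of_tendsto (h : HasGeometricChaining u D θ)
    (hθ : 0 < θ) {g : T → E} (hg : ∀ t, Tendsto (fun n => u n t) atTop (𝓝 (g t))) :
    ∃ K : ℝ≥0, ∀ n s t, edist s t ≤ D * 2⁻¹ ^ n → edist (g s) (g t) ≤ K * (2⁻¹ ^ θ) ^ n := by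
  obtain ⟨K, hstep, hlevel⟩ := h
  set r : ℝ≥0∞ := 2⁻¹ ^ θ
  have hlim (n t) : edist (u n t) (g t) ≤ K * r ^ n / (1 - r) :=
    edist_le_of_edist_le_geometric_of_tendsto r K (fun n => hstep n t) (hg t) n
  have htop : (K / (1 - r) + K + K / (1 - r) : ℝ≥0∞) ≠ ∞ := by
    have : (K : ℝ≥0∞) / (1 - r) ≠ ∞ :=
      ENNReal.div_ne_top ENNReal.coe_ne_top (tsub_pos_of_lt (inv_two_rpow_lt_one hθ)).ne'
    finiteness
  refine ⟨(K / (1 - r) + K + K / (1 - r) : ℝ≥0∞).toNNReal, fun n s t hst => ?_⟩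
  rw [ENNReal.coe_toNNReal htop]
  calc edist (g s) (g t)
      ≤ edist (g s) (u n s) + edist (u n s) (u n t) + edist (u n t) (g t) := edist_triangle4 ..
    _ ≤ K * r ^ n / (1 - r) + K * r ^ n + K * r ^ n / (1 - r) := by
        rw [edist_comm (g s)]
        gcongr
        exacts [hlim n s, hlevel n s t hst, hlim n t]
    _ = (K / (1 - r) + K + K / (1 - r)) * r ^ n := by
        simp only [ENNReal.div_eq_inv_mul]
        ring

theorem exists_dyadic_scale {x : ℝ≥0∞} (hx : x ≠ 0) (hxD : x ≤ D) :
    ∃ n : ℕ, D * 2⁻¹ ^ (n + 1) < x ∧ x ≤ D * 2⁻¹ ^ n := by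
  lift x to ℝ≥0 using ne_top_of_le_ne_top ENNReal.coe_ne_top hxD
  norm_cast at hx hxD
  have hD : 0 < D := (pos_iff_ne_zero.2 hx).trans_le hxD
  obtain ⟨n, hlt, hle⟩ := exists_nat_pow_near_of_lt_one (x := x / D) (y := 2⁻¹)
    (div_pos (pos_iff_ne_zero.2 hx) hD) (div_le_one_of_le₀ hxD hD.le) (by simp) (by
      rw [← NNReal.coe_lt_coe]; norm_num)
  rw [lt_div_iff₀' hD] at hlt
  rw [div_le_iff₀' hD] at hle
  rw [← ENNReal.coe_ofNat, ← ENNReal.coe_inv two_ne_zero]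
  exact ⟨n, by exact_mod_cast hlt, by exact_mod_cast hle⟩

theorem exists_edist_le_rpow_of_forall_dyadic (hθ : 0 < θ) (hD : ∀ s t : T, edist s t ≤ D)
    {g : T → E} {K : ℝ≥0}
    (hg : ∀ n s t, edist s t ≤ D * 2⁻¹ ^ n → edist (g s) (g t) ≤ K * (2⁻¹ ^ θ) ^ n) :
    ∃ L : ℝ≥0, ∀ s t, edist (g s) (g t) ≤ L * edist s t ^ θ := by
  refine ⟨K * (2 / D) ^ θ, fun s t => ?_⟩
  rcases eq_or_ne (edist s t) 0 with hst | hst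
  · have hzero : Tendsto (fun n : ℕ => (K : ℝ≥0∞) * (2⁻¹ ^ θ) ^ n) atTop (𝓝 0) := by
      simpa using ENNReal.Tendsto.const_mul (ENNReal.tendsto_pow_atTop_nhds_zero_of_lt_one
        (inv_two_rpow_lt_one hθ)) (.inr ENNReal.coe_ne_top)
    exact (ge_of_tendsto' hzero fun n => hg n s t (by simp [hst])).trans zero_le
  · obtain ⟨n, hlt, hle⟩ := exists_dyadic_scale hst (hD s t)
    have hD0 : D ≠ 0 := by
      rintro rfl
      exact hst (by simpa using hD s t)
    have hpow : (2⁻¹ : ℝ≥0∞) ^ n ≤ (2 / D : ℝ≥0) * edist s t := by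
      calc (2⁻¹ : ℝ≥0∞) ^ n = (2 / D : ℝ≥0) * (D * 2⁻¹ ^ (n + 1)) := by
            rw [← ENNReal.coe_ofNat, ← ENNReal.coe_inv two_ne_zero]
            norm_cast
            field_simp
            ring
        _ ≤ _ := by gcongr
    calc edist (g s) (g t) ≤ K * (2⁻¹ ^ n) ^ θ := by
          simpa only [← ENNReal.rpow_natCast, ← ENNReal.rpow_mul, mul_comm θ] using hg n s t hle
      _ ≤ K * ((2 / D : ℝ≥0) * edist s t) ^ θ := by gcongr
      _ = (K * (2 / D) ^ θ : ℝ≥0) * edist s t ^ θ := by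
          rw [ENNReal.mul_rpow_of_nonneg _ _ hθ.le, ENNReal.coe_mul,
            ENNReal.coe_rpow_of_nonneg _ hθ.le, mul_assoc]

theorem HasGeometricChaining.exists_holder_of_tendsto (h : HasGeometricChaining u D θ)
    (hθ : 0 < θ) (hD : ∀ s t : T, edist s t ≤ D) {g : T → E}
    (hg : ∀ t, Tendsto (fun n => u n t) atTop (𝓝 (g t))) :
    ∃ L : ℝ≥0, ∀ s t, edist (g s) (g t) ≤ L * edist s t ^ θ :=
  let ⟨_, hK⟩ := h.exists_edist_le_of_tendsto hθ hg
  exists_edist_le_rpow_of_forall_dyadic hθ hD hK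

end Deterministic

section Moments

variable {Ω : Type*} [MeasurableSpace Ω] {P : Measure Ω}

theorem summable_succ_pow_mul_geometric (k : ℕ) {ρ : ℝ≥0} (hρ : ρ < 1) :
    Summable fun n : ℕ => ((n + 1 : ℕ) : ℝ≥0) ^ k * ρ ^ n := by
  have h : Summable fun n : ℕ => (n : ℝ≥0) ^ k * ρ ^ n := by
    rw [← NNReal.summable_coe]
    push_cast
    exact summable_pow_mul_geometric_of_norm_lt_one k (by simpa using hρ)
  refine NNReal.summable_of_le (fun n => ?_)
    ((h.add (NNReal.summable_geometric hρ)).mul_left (2 ^ (k - 1)))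
  calc ((n + 1 : ℕ) : ℝ≥0) ^ k * ρ ^ n ≤ 2 ^ (k - 1) * (n ^ k + 1 ^ k) * ρ ^ n := by
        push_cast
        gcongr
        exact add_pow_le zero_le zero_le k
    _ = 2 ^ (k - 1) * (n ^ k * ρ ^ n + ρ ^ n) := by ring

theorem tsum_succ_rpow_mul_geometric_ne_top (q : ℝ) {ρ : ℝ≥0∞} (hρ : ρ < 1) :
    ∑' n : ℕ, ((n + 1 : ℕ) : ℝ≥0∞) ^ q * ρ ^ n ≠ ∞ := by
  lift ρ to ℝ≥0 using hρ.ne_top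
  refine ne_top_of_le_ne_top (ENNReal.tsum_coe_ne_top_iff_summable.2
    (summable_succ_pow_mul_geometric ⌈q⌉₊ (by exact_mod_cast hρ)))
    (ENNReal.tsum_le_tsum fun n => ?_)
  push_cast
  gcongr
  rw [← ENNReal.rpow_natCast]
  exact ENNReal.rpow_le_rpow_of_exponent_le (by simp) (Nat.le_ceil q)

theorem ae_exists_le_mul_of_tsum_lintegral_rpow_ne_top {Z : ℕ → Ω → ℝ≥0∞}
    (hZ : ∀ n, Measurable (Z n)) {p : ℝ} (hp : 0 < p) {w : ℕ → ℝ≥0∞} (hw0 : ∀ n, w n ≠ 0)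
    (hw : ∀ n, w n ≠ ∞) (hsum : ∑' n, (∫⁻ ω, Z n ω ^ p ∂P) / w n ^ p ≠ ∞) :
    ∀ᵐ ω ∂P, ∃ K : ℝ≥0, ∀ n, Z n ω ≤ K * w n := by
  have hmeas (n : ℕ) : Measurable fun ω => (Z n ω / w n) ^ p :=
    ((hZ n).div_const _).pow_const p
  have hfinite : ∫⁻ ω, ∑' n, (Z n ω / w n) ^ p ∂P ≠ ∞ := by
    rw [lintegral_tsum fun n => (hmeas n).aemeasurable]
    simp only [ENNReal.div_rpow_of_nonneg _ _ hp.le]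
    simp only [div_eq_mul_inv] at hsum ⊢
    simpa only [lintegral_mul_const _ ((hZ _).pow_const p)] using hsum
  filter_upwards [ae_lt_top (Measurable.tsum hmeas) hfinite] with ω hω
  set s := ∑' n, (Z n ω / w n) ^ p
  refine ⟨(s ^ p⁻¹).toNNReal, fun n => ?_⟩
  rw [ENNReal.coe_toNNReal (ENNReal.rpow_ne_top_of_nonneg (by positivity) hω.ne),
    ← ENNReal.div_le_iff (hw0 n) (hw n), ENNReal.le_rpow_inv_iff hp]
  exact ENNReal.le_tsum n

variable {T E : Type*} [PseudoEMetricSpace T] [PseudoEMetricSpace E]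

/-- The modulus of continuity at scale `δ` of the restriction of `f` to the finite set `J`. -/
noncomputable def modulusOn (J : Finset T) (δ : ℝ≥0∞) (f : T → E) : ℝ≥0∞ :=
  ⨆ (s : J) (t : {t : J // edist s t ≤ δ}), edist (f s) (f t)

theorem edist_le_modulusOn {J : Finset T} {δ : ℝ≥0∞} {s t : T} (hs : s ∈ J) (ht : t ∈ J)
    (hst : edist s t ≤ δ) (f : T → E) : edist (f s) (f t) ≤ modulusOn J δ f :=
  le_iSup_of_le ⟨s, hs⟩ (le_iSup_of_le ⟨⟨t, ht⟩, hst⟩ le_rfl)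

variable {X : T → Ω → E} {p q : ℝ} {M : ℝ≥0}

theorem measurable_modulusOn (hX : IsKolmogorovProcess X P p q M) (J : Finset T) (δ : ℝ≥0∞) :
    Measurable fun ω => modulusOn J δ fun t => X t ω :=
  .iSup fun _ => .iSup fun _ => hX.measurable_edist

theorem lintegral_iSup_edist_rpow_le (hX : IsKolmogorovProcess X P p q M) {K : Finset (T × T)}
    {δ : ℝ≥0∞} (hK : ∀ s t, (s, t) ∈ K → edist s t ≤ δ) :
    ∫⁻ ω, (⨆ z : K, edist (X z.1.1 ω) (X z.1.2 ω)) ^ p ∂P ≤ K.card * (M * δ ^ q) := by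
  have hsup (ω : Ω) : (⨆ z : K, edist (X z.1.1 ω) (X z.1.2 ω)) ^ p
      ≤ ∑ z ∈ K, edist (X z.1 ω) (X z.2 ω) ^ p := by
    rw [← ENNReal.le_rpow_inv_iff hX.p_pos]
    refine iSup_le fun z => (ENNReal.le_rpow_inv_iff hX.p_pos).2 ?_
    exact Finset.single_le_sum (f := fun z : T × T => edist (X z.1 ω) (X z.2 ω) ^ p)
      (fun _ _ => zero_le) z.2
  calc ∫⁻ ω, (⨆ z : K, edist (X z.1.1 ω) (X z.1.2 ω)) ^ p ∂P
      ≤ ∑ z ∈ K, ∫⁻ ω, edist (X z.1 ω) (X z.2 ω) ^ p ∂P :=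
        (lintegral_mono hsup).trans_eq
          (lintegral_finsetSum _ fun z _ => hX.measurable_edist.pow_const p)
    _ ≤ ∑ _z ∈ K, M * δ ^ q := Finset.sum_le_sum fun z hz =>
        (hX.kolmogorovCondition z.1 z.2).trans <|
          mul_right_mono <| ENNReal.rpow_le_rpow (hK _ _ hz) hX.q_pos.le
    _ = K.card * (M * δ ^ q) := by rw [Finset.sum_const, nsmul_eq_mul]

theorem lintegral_modulusOn_rpow_le (hX : IsKolmogorovProcess X P p q M) {J : Finset T}
    {a : ℝ≥0∞} {n : ℕ} (hJ : J.card ≤ a ^ n) (δ : ℝ≥0∞) :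
    ∫⁻ ω, modulusOn J δ (fun t => X t ω) ^ p ∂P
      ≤ 2 ^ p * (a * J.card * (M * (n * δ) ^ q)) := by
  -- a union bound over all pairs would cost `J.card ^ 2`, hence the threshold `q > 2 d`; reducing
  -- to few pairs keeps it linear in `J.card`, for distances up to `n * δ`
  obtain ⟨K, -, hKcard, hKdist, hK⟩ := EMetric.pair_reduction hJ δ E
  calc ∫⁻ ω, modulusOn J δ (fun t => X t ω) ^ p ∂P
      ≤ ∫⁻ ω, (2 * ⨆ z : K, edist (X z.1.1 ω) (X z.1.2 ω)) ^ p ∂P :=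
        lintegral_mono fun ω => ENNReal.rpow_le_rpow (hK fun t => X t ω) hX.p_pos.le
    _ = 2 ^ p * ∫⁻ ω, (⨆ z : K, edist (X z.1.1 ω) (X z.1.2 ω)) ^ p ∂P := by
        simp only [ENNReal.mul_rpow_of_nonneg _ _ hX.p_pos.le]
        exact lintegral_const_mul _ ((Measurable.iSup fun _ => hX.measurable_edist).pow_const p)
    _ ≤ 2 ^ p * (K.card * (M * (n * δ) ^ q)) := by
        gcongr
        exact lintegral_iSup_edist_rpow_le hX hKdist
    _ ≤ 2 ^ p * (a * J.card * (M * (n * δ) ^ q)) := by gcongr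

end Moments

section Nets

variable {Ω : Type*} [MeasurableSpace Ω] {P : Measure Ω} {T E : Type*} [PseudoEMetricSpace T]
  [PseudoEMetricSpace E] {X : T → Ω → E} {p q d θ : ℝ} {M c D : ℝ≥0}

/-- The pseudometric space `T` has diameter at most `D` and, for `ε ∈ (0, 1]`, can be covered by at
most `c * ε ^ (-d)` balls of radius `D * ε`: a quantitative form of the bound `d` on the upper
Minkowski dimension. -/
structure HasPolynomialCovering (T : Type*) [PseudoEMetricSpace T] (D c : ℝ≥0) (d : ℝ) :
    Prop where
  edist_le : ∀ s t : T, edist s t ≤ D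
  coveringNumber_le : ∀ ε : ℝ≥0, 0 < ε → ε ≤ 1 →
    (coveringNumber (D * ε) (univ : Set T) : ℝ≥0∞) ≤ (c * ε ^ (-d) : ℝ≥0)

theorem HasPolynomialCovering.exists_net (h : HasPolynomialCovering T D c d) (n : ℕ) :
    ∃ A : Finset T, (A.card : ℝ≥0∞) ≤ c * (2 ^ d) ^ n ∧ ∀ t, ∃ s ∈ A, edist t s ≤ D * 2⁻¹ ^ n := by
  have hle := h.coveringNumber_le (2⁻¹ ^ n) (by positivity)
    (pow_le_one₀ (by positivity) (by simp [inv_le_one_iff₀]))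
  have htop : coveringNumber (D * 2⁻¹ ^ n) (univ : Set T) ≠ ⊤ := by
    intro htop
    rw [htop, ENat.toENNReal_top] at hle
    exact ENNReal.coe_ne_top (top_le_iff.1 hle)
  refine ⟨(finite_minimalCover (ε := D * 2⁻¹ ^ n) (A := univ)).toFinset, ?_, fun t => ?_⟩
  · rw [← encard_minimalCover htop, finite_minimalCover.encard_eq_coe_toFinset_card] at hle
    refine hle.trans_eq ?_
    rw [NNReal.rpow_neg, ← NNReal.inv_rpow, inv_pow, inv_inv, ← NNReal.rpow_natCast,
      ← NNReal.rpow_mul, mul_comm (n : ℝ), NNReal.rpow_mul, NNReal.rpow_natCast]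
    rw [ENNReal.coe_mul, ENNReal.coe_pow, ENNReal.coe_rpow_of_ne_zero two_ne_zero,
      ENNReal.coe_ofNat]
  · obtain ⟨s, hs, hts⟩ := isCover_minimalCover htop (mem_univ t)
    refine ⟨s, by simpa using hs, hts.trans_eq ?_⟩
    rw [ENNReal.coe_mul, ENNReal.coe_pow, ENNReal.coe_inv two_ne_zero, ENNReal.coe_ofNat]

theorem hasGeometricChaining_of_modulusOn_le [DecidableEq T] {A : ℕ → Finset T} {φ : ℕ → T → T}
    (hφA : ∀ n t, φ n t ∈ A n) (hφ : ∀ n t, edist t (φ n t) ≤ D * 2⁻¹ ^ n) {f : T → E} {K : ℝ≥0}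
    (hK : ∀ n, modulusOn (A n ∪ A (n + 1)) ((3 * D : ℝ≥0) * 2⁻¹ ^ n) f ≤ K * (2⁻¹ ^ θ) ^ n) :
    HasGeometricChaining (fun n t => f (φ n t)) D θ := by
  have hthree (n : ℕ) : ((3 * D : ℝ≥0) : ℝ≥0∞) * 2⁻¹ ^ n
      = D * 2⁻¹ ^ n + D * 2⁻¹ ^ n + D * 2⁻¹ ^ n := by
    push_cast
    ring
  refine ⟨K, fun n t => (edist_le_modulusOn (Finset.mem_union_left _ (hφA n t))
    (Finset.mem_union_right _ (hφA (n + 1) t)) ?_ f).trans (hK n), fun n s t hst =>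
    (edist_le_modulusOn (Finset.mem_union_left _ (hφA n s))
      (Finset.mem_union_left _ (hφA n t)) ?_ f).trans (hK n)⟩
  · calc edist (φ n t) (φ (n + 1) t) ≤ edist t (φ n t) + edist t (φ (n + 1) t) :=
          edist_triangle_left ..
      _ ≤ D * 2⁻¹ ^ n + D * 2⁻¹ ^ (n + 1) := add_le_add (hφ n t) (hφ (n + 1) t)
      _ ≤ D * 2⁻¹ ^ n + D * 2⁻¹ ^ n := by
          gcongr _ + _ * ?_
          exact pow_le_pow_of_le_one zero_le (by simp) n.le_succ
      _ ≤ _ := (hthree n).symm ▸ le_self_add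
  · calc edist (φ n s) (φ n t) ≤ edist (φ n s) s + edist s t + edist t (φ n t) :=
          edist_triangle4 ..
      _ ≤ D * 2⁻¹ ^ n + D * 2⁻¹ ^ n + D * 2⁻¹ ^ n := by
          rw [edist_comm (φ n s)]
          gcongr
          exacts [hφ n s, hφ n t]
      _ = _ := (hthree n).symm

theorem chaining_ratio_lt_one (hp : 0 < p) (hθ : θ < (q - d) / p) :
    (2 : ℝ≥0∞) ^ d * 2⁻¹ ^ q / (2⁻¹ ^ θ) ^ p < 1 := by
  have h : (2 : ℝ≥0∞) ^ d * 2⁻¹ ^ q / (2⁻¹ ^ θ) ^ p = 2 ^ (d - q + θ * p) := by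
    simp only [ENNReal.inv_rpow, ENNReal.rpow_add _ _ two_ne_zero ENNReal.ofNat_ne_top,
      ENNReal.rpow_sub _ _ two_ne_zero ENNReal.ofNat_ne_top, div_eq_mul_inv, inv_inv,
      ENNReal.rpow_mul]
  rw [lt_div_iff₀ hp] at hθ
  exact h ▸ ENNReal.rpow_lt_one_of_one_lt_of_neg (by simp) (by linarith)

theorem mul_pow_le_pow_succ (a x : ℝ≥0∞) (n : ℕ) :
    a * x ^ n ≤ ((1 + a) * (1 + x)) ^ (n + 1) := by
  calc a * x ^ n ≤ (1 + a) ^ (n + 1) * (1 + x) ^ (n + 1) := by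
        gcongr
        · exact le_add_self.trans (le_self_pow₀ le_self_add n.succ_ne_zero)
        exacts [le_self_add, le_add_self, n.le_succ]
    _ = ((1 + a) * (1 + x)) ^ (n + 1) := (mul_pow ..).symm

theorem ae_exists_modulusOn_le (hX : IsKolmogorovProcess X P p q M) {J : ℕ → Finset T} {a : ℝ≥0}
    (hJ : ∀ n, ((J n).card : ℝ≥0∞) ≤ a * (2 ^ d) ^ n) (k : ℝ≥0) (hθ : θ < (q - d) / p) :
    ∀ᵐ ω ∂P, ∃ K : ℝ≥0, ∀ n,
      modulusOn (J n) (k * 2⁻¹ ^ n) (fun t => X t ω) ≤ K * (2⁻¹ ^ θ) ^ n := by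
  set b : ℝ≥0∞ := (1 + a) * (1 + 2 ^ d)
  set ρ : ℝ≥0∞ := 2 ^ d * 2⁻¹ ^ q / (2⁻¹ ^ θ) ^ p
  set L : ℝ≥0∞ := 2 ^ p * b * a * M * k ^ q
  have hb : b ≠ ∞ := by finiteness
  have hL : L ≠ ∞ := by
    have : (k : ℝ≥0∞) ^ q ≠ ∞ := ENNReal.rpow_ne_top_of_nonneg hX.q_pos.le ENNReal.coe_ne_top
    finiteness
  have hterm (n : ℕ) : (∫⁻ ω, modulusOn (J n) (k * 2⁻¹ ^ n) (fun t => X t ω) ^ p ∂P)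
      / ((2⁻¹ ^ θ) ^ n) ^ p ≤ L * (((n + 1 : ℕ) : ℝ≥0∞) ^ q * ρ ^ n) := by
    have hswap (x : ℝ≥0∞) (y : ℝ) : (x ^ n) ^ y = (x ^ y) ^ n := by
      simp only [← ENNReal.rpow_natCast, ← ENNReal.rpow_mul, mul_comm]
    calc _ ≤ 2 ^ p * (b * (a * (2 ^ d) ^ n) * (M * ((n + 1 : ℕ) * (k * 2⁻¹ ^ n)) ^ q))
          / ((2⁻¹ ^ θ) ^ n) ^ p := by
          gcongr
          refine (lintegral_modulusOn_rpow_le hX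
            ((hJ n).trans (mul_pow_le_pow_succ _ _ n)) _).trans ?_
          gcongr
          exact hJ n
      _ = L * (((n + 1 : ℕ) : ℝ≥0∞) ^ q * ρ ^ n) := by
          simp only [ENNReal.mul_rpow_of_nonneg _ _ hX.q_pos.le, hswap, ρ, L, div_eq_mul_inv,
            mul_pow, ENNReal.inv_pow]
          ring
  refine ae_exists_le_mul_of_tsum_lintegral_rpow_ne_top (fun n => measurable_modulusOn hX _ _)
    hX.p_pos (fun n => by simp) (fun n => ENNReal.pow_ne_top (by simp)) ?_
  refine ne_top_of_le_ne_top (b := L * ∑' n : ℕ, ((n + 1 : ℕ) : ℝ≥0∞) ^ q * ρ ^ n) ?_ ?_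
  · exact ENNReal.mul_ne_top hL
      (tsum_succ_rpow_mul_geometric_ne_top q (chaining_ratio_lt_one hX.p_pos hθ))
  · rw [← ENNReal.tsum_mul_left]
    exact ENNReal.tsum_le_tsum hterm

theorem HasPolynomialCovering.exists_chaining (h : HasPolynomialCovering T D c d)
    (hX : IsKolmogorovProcess X P p q M) :
    ∃ φ : ℕ → T → T, (∀ n t, edist t (φ n t) ≤ D * 2⁻¹ ^ n) ∧ ∀ θ < (q - d) / p,
      ∀ᵐ ω ∂P, HasGeometricChaining (fun n t => X (φ n t) ω) D θ := by
  classical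
  choose A hAcard hA using h.exists_net
  choose φ hφA hφ using hA
  refine ⟨φ, hφ, fun θ hθ => ?_⟩
  have hcard (n : ℕ) : ((A n ∪ A (n + 1)).card : ℝ≥0∞)
      ≤ (c * (1 + 2 ^ d) : ℝ≥0) * (2 ^ d) ^ n := by
    calc ((A n ∪ A (n + 1)).card : ℝ≥0∞) ≤ (A n).card + (A (n + 1)).card := by
          exact_mod_cast Finset.card_union_le _ _
      _ ≤ c * (2 ^ d) ^ n + c * (2 ^ d) ^ (n + 1) := add_le_add (hAcard n) (hAcard (n + 1))
      _ = (c * (1 + 2 ^ d) : ℝ≥0) * (2 ^ d) ^ n := by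
          push_cast [ENNReal.coe_rpow_of_ne_zero two_ne_zero]
          ring
  filter_upwards [ae_exists_modulusOn_le hX hcard (3 * D) hθ] with ω ⟨K, hK⟩
  exact hasGeometricChaining_of_modulusOn_le hφA hφ hK

end Nets

section Modification

variable {Ω : Type*} [MeasurableSpace Ω] {P : Measure Ω} {T E : Type*} [EMetricSpace E]

theorem exists_measurable_forall_tendsto [MeasurableSpace E] [BorelSpace E] {u : ℕ → T → Ω → E}
    (hu : ∀ n t, Measurable (u n t))
    (hlim : ∀ᵐ ω ∂P, ∀ t, ∃ y, Tendsto (fun n => u n t ω) atTop (𝓝 y)) :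
    ∃ Y : T → Ω → E, (∀ t, Measurable (Y t)) ∧
      ∀ᵐ ω ∂P, ∀ t, Tendsto (fun n => u n t ω) atTop (𝓝 (Y t ω)) := by
  classical
  obtain ⟨G, hGP, hG, hGlim⟩ := hlim.exists_measurable_mem
  have hv (t : T) (ω : Ω) :
      ∃ y, Tendsto (fun n => G.piecewise (u n t) (u 0 t) ω) atTop (𝓝 y) := by
    by_cases hω : ω ∈ G
    · simpa only [piecewise_eq_of_mem _ _ _ hω] using hGlim ω hω t
    · simpa only [piecewise_eq_of_notMem _ _ _ hω] using ⟨_, tendsto_const_nhds⟩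
  choose Y hY using hv
  refine ⟨Y, fun t => measurable_of_tendsto_metrizable
    (fun n => (hu n t).piecewise hG (hu 0 t)) (tendsto_pi_nhds.2 (hY t)), ?_⟩
  filter_upwards [hGP] with ω hω t
  simpa only [piecewise_eq_of_mem _ _ _ hω] using hY t ω

variable [PseudoEMetricSpace T] {X : T → Ω → E} {p q d : ℝ} {M c D : ℝ≥0}

theorem ae_eq_of_tendsto (hX : IsKolmogorovProcess X P p q M) {s : ℕ → T} {t : T}
    (hs : Tendsto (fun n => edist t (s n)) atTop (𝓝 0)) {Y : Ω → E}
    (hY : ∀ᵐ ω ∂P, Tendsto (fun n => X (s n) ω) atTop (𝓝 (Y ω))) : Y =ᵐ[P] X t := by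
  have hmeas (n : ℕ) : Measurable fun ω => edist (X t ω) (X (s n) ω) ^ p :=
    hX.measurable_edist.pow_const p
  have hmoment : Tendsto (fun n => M * edist t (s n) ^ q) atTop (𝓝 0) := by
    have h : Tendsto (fun n => edist t (s n) ^ q) atTop (𝓝 0) := by
      simpa only [ENNReal.zero_rpow_of_pos hX.q_pos] using hs.ennrpow_const q
    simpa only [mul_zero] using ENNReal.Tendsto.const_mul h (.inr ENNReal.coe_ne_top)
  have hfatou : ∫⁻ ω, liminf (fun n => edist (X t ω) (X (s n) ω) ^ p) atTop ∂P = 0 := by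
    refine le_antisymm ((lintegral_liminf_le hmeas).trans ?_) zero_le
    rw [← hmoment.liminf_eq]
    exact liminf_le_liminf (.of_forall fun n => hX.kolmogorovCondition t (s n))
  filter_upwards [hY, (lintegral_eq_zero_iff (Measurable.liminf hmeas)).1 hfatou] with ω hω hzero
  have hlim : Tendsto (fun n => edist (X t ω) (X (s n) ω) ^ p) atTop
      (𝓝 (edist (X t ω) (Y ω) ^ p)) := (tendsto_const_nhds.edist hω).ennrpow_const p
  rw [hlim.liminf_eq, Pi.zero_apply, ENNReal.rpow_eq_zero_iff_of_pos hX.p_pos] at hzero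
  exact (edist_eq_zero.1 hzero).symm

theorem HasPolynomialCovering.exists_essentiallyHolder_modification [CompleteSpace E]
    [MeasurableSpace E] [BorelSpace E] (hT : HasPolynomialCovering T D c d)
    (hX : IsKolmogorovProcess X P p q M) (hdq : d < q) :
    ∃ Y : T → Ω → E, (∀ t, Measurable (Y t)) ∧ (∀ t, Y t =ᵐ[P] X t) ∧
      ∀ᵐ ω ∂P, PCF.EssentiallyHolder edist ((q - d) / p) fun t => Y t ω := by
  obtain ⟨φ, hφ, hchain⟩ := hT.exists_chaining hX
  have hrat : ∀ᵐ ω ∂P, ∀ κ : ℚ, (κ : ℝ) < (q - d) / p →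
      HasGeometricChaining (fun n t => X (φ n t) ω) D κ :=
    ae_all_iff.2 fun κ => eventually_imp_distrib_left.2 (hchain κ)
  obtain ⟨κ₀, hκ₀, hκ₀'⟩ := exists_rat_btwn (div_pos (sub_pos.2 hdq) hX.p_pos)
  obtain ⟨Y, hYmeas, hY⟩ := exists_measurable_forall_tendsto (P := P)
    (fun n t => hX.measurable (φ n t))
    (hrat.mono fun ω hω t => (hω κ₀ hκ₀').exists_tendsto hκ₀ t)
  have hφlim (t : T) : Tendsto (fun n => edist t (φ n t)) atTop (𝓝 0) := by
    refine tendsto_of_tendsto_of_tendsto_of_le_of_le tendsto_const_nhds ?_ (fun _ => zero_le)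
      fun n => hφ n t
    simpa using ENNReal.Tendsto.const_mul
      (ENNReal.tendsto_pow_atTop_nhds_zero_of_lt_one (r := 2⁻¹) (by simp))
      (.inr (ENNReal.coe_ne_top (r := D)))
  refine ⟨Y, hYmeas, fun t => ae_eq_of_tendsto hX (hφlim t) (hY.mono fun ω hω => hω t), ?_⟩
  filter_upwards [hrat, hY] with ω hω hYω θ hθ hθ'
  obtain ⟨κ, hκ, hκ'⟩ := exists_rat_btwn hθ'
  exact ((hω κ hκ').mono hκ.le).exists_holder_of_tendsto hθ hT.edist_le hYω

end Modification

section IteratedFunctionSystem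

variable {T T' ι : Type*} [PseudoEMetricSpace T] [PseudoEMetricSpace T']

theorem coveringNumber_range_le {ψ : T → T'} {s : ℝ≥0} (hψ : LipschitzWith s ψ) (δ : ℝ≥0) :
    coveringNumber (s * δ) (range ψ) ≤ coveringNumber δ (univ : Set T) := by
  by_cases htop : coveringNumber δ (univ : Set T) = ⊤
  · exact htop ▸ le_top
  · rw [← encard_minimalCover htop]
    have hcover : IsCover (s * δ) (range ψ) (ψ '' minimalCover δ univ) := by
      rw [← image_univ]
      exact (isCover_minimalCover htop).image_lipschitz hψ
    exact (hcover.coveringNumber_le_encard (image_subset_range ..)).trans (encard_image_le ..)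

theorem coveringNumber_iUnion_le [Fintype ι] (ε : ℝ≥0) (A : ι → Set T) :
    coveringNumber ε (⋃ i, A i) ≤ ∑ i, coveringNumber ε (A i) := by
  by_cases htop : ∃ i, coveringNumber ε (A i) = ⊤
  · obtain ⟨i, hi⟩ := htop
    exact le_top.trans (hi.symm.le.trans (Finset.single_le_sum_of_canonicallyOrdered
      (f := fun i => coveringNumber ε (A i)) (Finset.mem_univ i)))
  · push Not at htop
    have hcover : IsCover ε (⋃ i, A i) (⋃ i, minimalCover ε (A i)) := by
      rintro x hx
      obtain ⟨i, hi⟩ := mem_iUnion.1 hx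
      obtain ⟨y, hy, hxy⟩ := isCover_minimalCover (htop i) hi
      exact ⟨y, mem_iUnion.2 ⟨i, hy⟩, hxy⟩
    calc coveringNumber ε (⋃ i, A i) ≤ (⋃ i, minimalCover ε (A i)).encard :=
          hcover.coveringNumber_le_encard (iUnion_mono fun i => minimalCover_subset)
      _ ≤ ∑ i, (minimalCover ε (A i)).encard := encard_iUnion_le_of_fintype _
      _ = ∑ i, coveringNumber ε (A i) := by simp only [encard_minimalCover (htop _)]

theorem coveringNumber_le_rpow_of_one_le {D m ε : ℝ≥0} {d : ℝ} (hd : 0 ≤ d)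
    (hD : ∀ x y : T, edist x y ≤ D) (hm : 0 < m) (h1ε : 1 ≤ ε) (hεm : ε ≤ m⁻¹) :
    (coveringNumber (D * ε) (univ : Set T) : ℝ≥0∞) ≤ (m ^ (-d) * ε ^ (-d) : ℝ≥0) := by
  have hN : coveringNumber (D * ε) (univ : Set T) ≤ 1 :=
    coveringNumber_le_one_of_ediam_le <| ediam_le fun x _ y _ =>
      (hD x y).trans (by exact_mod_cast le_mul_of_one_le_right zero_le h1ε)
  have hmε : 1 ≤ m ^ (-d) * ε ^ (-d) := by
    rw [← NNReal.mul_rpow, NNReal.rpow_neg]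
    refine (one_le_inv₀ (NNReal.rpow_pos (mul_pos hm (one_pos.trans_le h1ε)))).2
      (NNReal.rpow_le_one ?_ hd)
    rwa [mul_comm, ← NNReal.le_inv_iff_mul_le hm.ne']
  calc (coveringNumber (D * ε) (univ : Set T) : ℝ≥0∞) ≤ 1 := by exact_mod_cast hN
    _ ≤ _ := by exact_mod_cast hmε

variable [Fintype ι] {ψ : ι → T → T} {s : ι → ℝ≥0} {D : ℝ≥0} {d : ℝ}

theorem coveringNumber_le_sum_coveringNumber_div (hψ : ∀ i, LipschitzWith (s i) (ψ i))
    (hcover : ⋃ i, range (ψ i) = univ) (hs : ∀ i, 0 < s i) (δ : ℝ≥0) :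
    coveringNumber δ (univ : Set T) ≤ ∑ i, coveringNumber (δ / s i) (univ : Set T) := by
  rw [← hcover]
  refine (coveringNumber_iUnion_le ..).trans (Finset.sum_le_sum fun i _ => ?_)
  rw [hcover]
  simpa only [mul_div_cancel₀ _ (hs i).ne'] using coveringNumber_range_le (hψ i) (δ / s i)

theorem coveringNumber_le_rpow_of_pow_le (hψ : ∀ i, LipschitzWith (s i) (ψ i))
    (hcover : ⋃ i, range (ψ i) = univ) (hd : 0 ≤ d) (hsum : ∑ i, s i ^ d = 1)
    (hD : ∀ x y : T, edist x y ≤ D) {m σ : ℝ≥0} (hm : 0 < m) (hms : ∀ i, m ≤ s i)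
    (hsσ : ∀ i, s i ≤ σ) (n : ℕ) {ε : ℝ≥0} (hε : 0 < ε) (hσε : σ ^ n ≤ ε) (hεm : ε ≤ m⁻¹) :
    (coveringNumber (D * ε) (univ : Set T) : ℝ≥0∞) ≤ (m ^ (-d) * ε ^ (-d) : ℝ≥0) := by
  induction n generalizing ε with
  | zero => exact coveringNumber_le_rpow_of_one_le hd hD hm (by simpa using hσε) hεm
  | succ n ih =>
    rcases le_total 1 ε with h1ε | hε1
    · exact coveringNumber_le_rpow_of_one_le hd hD hm h1ε hεm
    have hs (i : ι) : 0 < s i := hm.trans_le (hms i)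
    have hstep (i : ι) : (coveringNumber (D * (ε / s i)) (univ : Set T) : ℝ≥0∞)
        ≤ (m ^ (-d) * (ε / s i) ^ (-d) : ℝ≥0) := by
      refine ih (div_pos hε (hs i)) ?_ ?_
      · rw [le_div_iff₀ (hs i)]
        exact (mul_le_mul_of_nonneg_left (hsσ i) zero_le).trans (pow_succ σ n ▸ hσε)
      · calc ε / s i ≤ 1 / m := by gcongr; exact hms i
          _ = m⁻¹ := one_div m
    calc (coveringNumber (D * ε) (univ : Set T) : ℝ≥0∞)
        ≤ ∑ i, (coveringNumber (D * (ε / s i)) (univ : Set T) : ℝ≥0∞) := by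
          simp only [← mul_div_assoc]
          exact (ENat.toENNReal_mono
            (coveringNumber_le_sum_coveringNumber_div hψ hcover hs _)).trans_eq
            (map_sum ENat.toENNRealRingHom _ _)
      _ ≤ ∑ i, ((m ^ (-d) * (ε / s i) ^ (-d) : ℝ≥0) : ℝ≥0∞) :=
          Finset.sum_le_sum fun i _ => hstep i
      _ = (m ^ (-d) * ε ^ (-d) * ∑ i, s i ^ d : ℝ≥0) := by
          rw [Finset.mul_sum]
          push_cast
          refine Finset.sum_congr rfl fun i _ => ?_
          norm_cast
          rw [NNReal.div_rpow, NNReal.rpow_neg (s i), div_inv_eq_mul, mul_assoc]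
      _ = (m ^ (-d) * ε ^ (-d) : ℝ≥0) := by rw [hsum, mul_one]

theorem exists_hasPolynomialCovering_of_iUnion_range (hψ : ∀ i, LipschitzWith (s i) (ψ i))
    (hcover : ⋃ i, range (ψ i) = univ) (hs0 : ∀ i, 0 < s i) (hs1 : ∀ i, s i < 1) (hd : 0 ≤ d)
    (hsum : ∑ i, s i ^ d = 1) (hD : ∀ x y : T, edist x y ≤ D) :
    ∃ c : ℝ≥0, HasPolynomialCovering T D c d := by
  have hι : Nonempty ι := by
    by_contra h
    rw [not_nonempty_iff] at h
    simp at hsum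
  obtain ⟨i₀, hmin⟩ := Finite.exists_min s
  obtain ⟨i₁, hmax⟩ := Finite.exists_max s
  refine ⟨s i₀ ^ (-d), hD, fun ε hε hε1 => ?_⟩
  obtain ⟨n, hn⟩ := exists_pow_lt_of_lt_one hε (hs1 i₁)
  exact coveringNumber_le_rpow_of_pow_le hψ hcover hd hsum hD (hs0 i₀) hmin hmax n hε hn.le
    (hε1.trans (one_le_inv₀ (hs0 i₀) |>.2 (hs1 i₀).le))

end IteratedFunctionSystem

end KolmogorovChaining

namespace PCF

open Filter Topology

namespace SelfSimilarSet

variable {F : Type*} [MetricSpace F] [CompactSpace F] [ConnectedSpace F] {M : ℕ}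
  (S : SelfSimilarSet F M)

theorem continuous_ψ (i : Fin M) : Continuous (S.ψ i) :=
  (S.contracting i).choose_spec.2.continuous

theorem exists_ψ_eq (x : F) : ∃ i y, S.ψ i y = x := by
  simpa only [mem_iUnion, mem_range] using S.iUnion_range.ge (mem_univ x)

theorem code_mem_cell (ω : ℕ → Fin M) (n : ℕ) : S.code ω ∈ S.cell (pre ω n) :=
  (S.existsUnique_code ω).choose_spec.1 n

theorem eq_code {ω : ℕ → Fin M} {x : F} (h : ∀ n, x ∈ S.cell (pre ω n)) : x = S.code ω :=
  (S.existsUnique_code ω).unique h (S.code_mem_cell ω)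

theorem pre_succ_eq_cons (ω : ℕ → Fin M) (n : ℕ) :
    pre ω (n + 1) = ω 0 :: pre (fun k => ω (k + 1)) n := by
  simp [pre, List.ofFn_succ]

theorem ψ_code_shift (ω : ℕ → Fin M) : S.ψ (ω 0) (S.code fun k => ω (k + 1)) = S.code ω := by
  refine S.eq_code fun n => ?_
  cases n with
  | zero => exact ⟨_, rfl⟩
  | succ n =>
    obtain ⟨y, hy⟩ := S.code_mem_cell (fun k => ω (k + 1)) n
    exact ⟨y, by rw [pre_succ_eq_cons, ← hy]; rfl⟩

theorem code_surjective : Function.Surjective S.code := by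
  intro x
  choose i y hy using S.exists_ψ_eq
  refine ⟨fun n => i (y^[n] x), (S.eq_code fun n => ⟨y^[n] x, ?_⟩).symm⟩
  induction n with
  | zero => rfl
  | succ n ih =>
    rw [pre_succ, wordMap_append, Function.iterate_succ_apply', Function.comp_apply]
    simpa only [wordMap, Function.comp_id, hy] using ih

theorem tendsto_wordMap_pre (ω : ℕ → Fin M) (p : F) :
    Tendsto (fun n => S.wordMap (pre ω n) p) atTop (𝓝 (S.code ω)) := by
  obtain ⟨K, hK, hL⟩ := S.exists_lipschitz
  have hdist (n : ℕ) :
      dist (S.wordMap (pre ω n) p) (S.code ω) ≤ (K : ℝ) ^ n * Metric.diam (univ : Set F) := by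
    obtain ⟨y, hy⟩ := S.code_mem_cell ω n
    rw [← hy]
    refine ((hL _).dist_le_mul p y).trans ?_
    rw [pre, List.length_ofFn, NNReal.coe_pow]
    gcongr
    exact Metric.dist_le_diam_of_mem isCompact_univ.isBounded (mem_univ p) (mem_univ y)
  refine tendsto_iff_dist_tendsto_zero.2 (squeeze_zero (fun _ => dist_nonneg) hdist ?_)
  simpa using (tendsto_pow_atTop_nhds_zero_of_lt_one K.2 (by exact_mod_cast hK)).mul_const
    (Metric.diam (univ : Set F))

theorem dense_range_wordMap (p : F) : Dense (range fun w => S.wordMap w p) := by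
  intro x
  obtain ⟨ω, rfl⟩ := S.code_surjective x
  exact mem_closure_of_tendsto (S.tendsto_wordMap_pre ω p) (.of_forall fun n => mem_range_self _)

end SelfSimilarSet

namespace PCFSelfSimilarSet

variable {F : Type*} [MetricSpace F] [CompactSpace F] [ConnectedSpace F] {M : ℕ}
  (S : PCFSelfSimilarSet F M)

theorem mem_boundary_of_ψ_mem_range {i j : Fin M} (hij : i ≠ j) {y : F}
    (h : S.ψ i y ∈ range (S.ψ j)) : y ∈ S.boundary := by
  obtain ⟨τ, rfl⟩ := S.code_surjective y
  let ω : ℕ → Fin M := fun n => Nat.casesOn n i τ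
  have hω : S.ψ i (S.code τ) = S.code ω := S.ψ_code_shift ω
  have hcritical : ω ∈ S.criticalSet := ⟨i, j, hij, ⟨_, hω⟩, hω ▸ h⟩
  exact ⟨τ, ⟨1, le_rfl, ω, hcritical, rfl⟩, rfl⟩

theorem exists_ψ_eq_of_mem_boundary {x : F} (hx : x ∈ S.boundary) :
    ∃ i, ∃ y ∈ S.boundary, S.ψ i y = x := by
  obtain ⟨τ, ⟨n, hn, ω, hω, rfl⟩, rfl⟩ := hx
  refine ⟨_, _, ⟨_, ⟨n + 1, by omega, ω, hω, rfl⟩, ?_⟩, S.ψ_code_shift _⟩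
  exact congrArg S.code (funext fun k => congrArg ω (by omega))

theorem exists_boundary_link {I : Set (Fin M)} (hI : I.Nonempty) (hI' : Iᶜ.Nonempty) :
    ∃ i ∈ I, ∃ j ∈ Iᶜ, ∃ p ∈ S.boundary, ∃ q ∈ S.boundary, S.ψ i p = S.ψ j q := by
  have hclosed (J : Set (Fin M)) : IsClosed (⋃ i ∈ J, range (S.ψ i)) :=
    J.toFinite.isClosed_biUnion fun i _ => (isCompact_range (S.continuous_ψ i)).isClosed
  have hne {J : Set (Fin M)} : J.Nonempty → (⋃ i ∈ J, range (S.ψ i)).Nonempty := fun ⟨_, hi⟩ =>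
    ⟨_, mem_biUnion hi (mem_range_self (Classical.arbitrary F))⟩
  have hcover : univ ⊆ (⋃ i ∈ I, range (S.ψ i)) ∪ ⋃ i ∈ Iᶜ, range (S.ψ i) := by
    rw [← biUnion_union, union_compl_self, biUnion_univ, S.iUnion_range]
  -- `F` is connected, so the closed sets formed by the two groups of cells meet
  obtain ⟨x, -, hx, hx'⟩ := isPreconnected_closed_iff.1 (isPreconnected_univ (α := F)) _ _
    (hclosed I) (hclosed Iᶜ) hcover (by simpa using hne hI) (by simpa using hne hI')
  obtain ⟨i, hi, p, rfl⟩ := mem_iUnion₂.1 hx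
  obtain ⟨j, hj, q, hq⟩ := mem_iUnion₂.1 hx'
  have hij : i ≠ j := fun h => hj (h ▸ hi)
  exact ⟨i, hi, j, hj, p, S.mem_boundary_of_ψ_mem_range hij ⟨q, hq⟩, q,
    S.mem_boundary_of_ψ_mem_range hij.symm ⟨p, hq.symm⟩, hq.symm⟩

theorem boundary_nonempty : S.boundary.Nonempty := by
  have := Fin.nontrivial_iff_two_le.2 S.two_le
  obtain ⟨i, j, hij⟩ := exists_pair_ne (Fin M)
  obtain ⟨-, -, -, -, p, hp, -⟩ :=
    S.exists_boundary_link (singleton_nonempty i) ⟨j, hij.symm⟩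
  exact ⟨p, hp⟩

end PCFSelfSimilarSet

namespace IsLaplacian

variable {V : Type*} [Fintype V] {A : Matrix V V ℝ}

theorem row_sum (hA : IsLaplacian A) (p : V) : ∑ q, A p q = 0 := by
  simpa [Matrix.mulVec, dotProduct] using congrFun ((hA.ker fun _ => 1).2 ⟨1, rfl⟩) p

theorem mulVec_apply_eq_sum_sub (hA : IsLaplacian A) (u : V → ℝ) (p : V) :
    (A *ᵥ u) p = ∑ q, A p q * (u q - u p) := by
  simp only [Matrix.mulVec, dotProduct, mul_sub, Finset.sum_sub_distrib, ← Finset.sum_mul,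
    hA.row_sum, zero_mul, sub_zero]

theorem neg_dotProduct_mulVec_eq_sum_sq_sub (hA : IsLaplacian A) (u : V → ℝ) :
    -(u ⬝ᵥ (A *ᵥ u)) = 2⁻¹ * ∑ p, ∑ q, A p q * (u p - u q) ^ 2 := by
  have hdot : u ⬝ᵥ (A *ᵥ u) = ∑ p, ∑ q, A p q * (u p * (u q - u p)) := by
    simp only [dotProduct, hA.mulVec_apply_eq_sum_sub, Finset.mul_sum]
    exact Finset.sum_congr rfl fun p _ => Finset.sum_congr rfl fun q _ => by ring
  have hdot' : u ⬝ᵥ (A *ᵥ u) = ∑ p, ∑ q, A p q * (u q * (u p - u q)) := by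
    rw [hdot, Finset.sum_comm]
    simp only [hA.symm.apply]
  have hadd : -(2 * (u ⬝ᵥ (A *ᵥ u))) = ∑ p, ∑ q, A p q * (u p - u q) ^ 2 := by
    rw [two_mul]
    nth_rw 1 [hdot]
    rw [hdot']
    simp only [← Finset.sum_add_distrib, ← Finset.sum_neg_distrib]
    exact Finset.sum_congr rfl fun p _ => Finset.sum_congr rfl fun q _ => by ring
  linarith

theorem mul_sq_sub_le (hA : IsLaplacian A) (u : V → ℝ) (p q : V) :
    A p q * (u p - u q) ^ 2 ≤ 2 * -(u ⬝ᵥ (A *ᵥ u)) := by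
  have hnonneg (p q : V) : 0 ≤ A p q * (u p - u q) ^ 2 := by
    rcases eq_or_ne p q with rfl | hpq
    · simp
    · exact mul_nonneg (hA.offDiag p q hpq) (sq_nonneg _)
  rw [hA.neg_dotProduct_mulVec_eq_sum_sq_sub, mul_inv_cancel_left₀ two_ne_zero]
  calc A p q * (u p - u q) ^ 2 ≤ ∑ q, A p q * (u p - u q) ^ 2 :=
        Finset.single_le_sum (fun q _ => hnonneg p q) (Finset.mem_univ q)
    _ ≤ ∑ p, ∑ q, A p q * (u p - u q) ^ 2 :=
        Finset.single_le_sum (f := fun p => ∑ q, A p q * (u p - u q) ^ 2)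
          (fun p _ => Finset.sum_nonneg fun q _ => hnonneg p q) (Finset.mem_univ p)

theorem reflTransGen_pos (hA : IsLaplacian A) (p q : V) :
    Relation.ReflTransGen (fun a b => 0 < A a b) p q := by
  classical
  let U : Set V := {a | Relation.ReflTransGen (fun a b => 0 < A a b) p a}
  have hU {a b : V} (ha : a ∈ U) (hb : b ∉ U) : A a b = 0 :=
    (hA.offDiag a b fun h => hb (h ▸ ha)).antisymm' (not_lt.1 fun h => hb (ha.tail h))
  -- the indicator function of a connected component is harmonic, hence constant
  have hharmonic : A *ᵥ U.indicator 1 = 0 := by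
    ext a
    rw [hA.mulVec_apply_eq_sum_sub]
    refine Finset.sum_eq_zero fun b _ => ?_
    by_cases ha : a ∈ U <;> by_cases hb : b ∈ U
    · simp [ha, hb]
    · simp [hU ha hb]
    · rw [← hA.symm.apply, hU hb ha, zero_mul]
    · simp [ha, hb]
  obtain ⟨c, hc⟩ := (hA.ker _).1 hharmonic
  have hp : p ∈ U := .refl
  have hpq : U.indicator (1 : V → ℝ) q = U.indicator 1 p := by simp only [hc]
  by_contra hq
  simp [indicator_of_mem hp, indicator_of_notMem (show q ∉ U from hq)] at hpq

end IsLaplacian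

namespace PCFSelfSimilarSet

variable {F : Type*} [MetricSpace F] [CompactSpace F] [ConnectedSpace F] {M : ℕ}
  (S : PCFSelfSimilarSet F M) {A : Matrix S.boundary S.boundary ℝ} {r : Fin M → ℝ}

section LevelEnergy

theorem levelEnergy_zero (A : Matrix S.boundary S.boundary ℝ) (r : Fin M → ℝ) (f : F → ℝ) :
    S.levelEnergy A r 0 f = S.boundaryEnergy A fun p => f p := by
  simp [levelEnergy, SelfSimilarSet.wordMap]

theorem levelEnergy_succ (A : Matrix S.boundary S.boundary ℝ) (r : Fin M → ℝ) (n : ℕ)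
    (f : F → ℝ) :
    S.levelEnergy A r (n + 1) f = ∑ i, (r i)⁻¹ * S.levelEnergy A r n (f ∘ S.ψ i) := by
  simp only [levelEnergy, Finset.mul_sum]
  rw [← Fintype.sum_prod_type', ← (Fin.consEquiv fun _ : Fin (n + 1) => Fin M).sum_comp]
  refine Finset.sum_congr rfl fun ⟨i, w⟩ _ => ?_
  simp only [Fin.consEquiv_apply, Fin.prod_univ_succ, Fin.cons_zero, Fin.cons_succ, mul_inv,
    mul_assoc, List.ofFn_succ, SelfSimilarSet.wordMap, Function.comp_apply]

theorem levelEnergy_smul (A : Matrix S.boundary S.boundary ℝ) (r : Fin M → ℝ) (n : ℕ) (c : ℝ)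
    (f : F → ℝ) : S.levelEnergy A r n (c • f) = c ^ 2 * S.levelEnergy A r n f := by
  have hboundary (u : S.boundary → ℝ) :
      S.boundaryEnergy A (c • u) = c ^ 2 * S.boundaryEnergy A u := by
    simp only [boundaryEnergy, Matrix.mulVec_smul, smul_dotProduct, dotProduct_smul, smul_eq_mul]
    ring
  simp only [levelEnergy, Finset.mul_sum, mul_left_comm (c ^ 2), ← hboundary]
  rfl

theorem levelEnergy_sub_const (hA : IsLaplacian A) (r : Fin M → ℝ) (n : ℕ) (f : F → ℝ) (c : ℝ) :
    S.levelEnergy A r n (fun x => f x - c) = S.levelEnergy A r n f := by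
  simp only [levelEnergy, boundaryEnergy, hA.neg_dotProduct_mulVec_eq_sum_sq_sub,
    sub_sub_sub_cancel_right]

theorem levelEnergy_nonneg (hA : IsLaplacian A) (hr : ∀ i, 0 < r i) (n : ℕ) (f : F → ℝ) :
    0 ≤ S.levelEnergy A r n f :=
  Finset.sum_nonneg fun _ _ => mul_nonneg
    (inv_nonneg.2 (Finset.prod_nonneg fun _ _ => (hr _).le)) (neg_nonneg.2 (hA.nonpos _))

theorem levelEnergy_comp_ψ_le (hA : IsLaplacian A) (hr : ∀ i, 0 < r i) (n : ℕ) (f : F → ℝ)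
    (i : Fin M) : S.levelEnergy A r n (f ∘ S.ψ i) ≤ r i * S.levelEnergy A r (n + 1) f := by
  rw [S.levelEnergy_succ, ← inv_mul_le_iff₀ (hr i)]
  exact Finset.single_le_sum (f := fun i => (r i)⁻¹ * S.levelEnergy A r n (f ∘ S.ψ i))
    (fun j _ => mul_nonneg (inv_nonneg.2 (hr j).le) (S.levelEnergy_nonneg hA hr n _))
    (Finset.mem_univ i)

end LevelEnergy

section Energy

/-- The energy `supₙ 𝓔ₙ(f,f)` of a continuous function for a matrix `A` on `F⁰` and weights
`r`, whether or not `(A, r)` is a harmonic structure. -/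
noncomputable def energy (A : Matrix S.boundary S.boundary ℝ) (r : Fin M → ℝ) (f : C(F, ℝ)) :
    ℝ≥0∞ :=
  ⨆ n : ℕ, ENNReal.ofReal (S.levelEnergy A r n f)

/-- The effective resistance `(inf {𝓔(f,f) : 𝓔(f,f) < ∞, f(x) = 0, f(y) = 1})⁻¹` between two
points for the energy of `A` and `r`. -/
noncomputable def resistance (A : Matrix S.boundary S.boundary ℝ) (r : Fin M → ℝ) (x y : F) :
    ℝ≥0∞ :=
  (⨅ f ∈ {f : C(F, ℝ) | S.energy A r f < ∞ ∧ f x = 0 ∧ f y = 1}, S.energy A r f)⁻¹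

theorem energy_smul (A : Matrix S.boundary S.boundary ℝ) (r : Fin M → ℝ) (c : ℝ) (f : C(F, ℝ)) :
    S.energy A r (c • f) = ENNReal.ofReal (c ^ 2) * S.energy A r f := by
  simp only [energy, ContinuousMap.coe_smul, levelEnergy_smul,
    ENNReal.ofReal_mul (sq_nonneg c), ENNReal.mul_iSup]

theorem energy_sub_const (hA : IsLaplacian A) (r : Fin M → ℝ) (f : C(F, ℝ)) (c : ℝ) :
    S.energy A r (f - .const F c) = S.energy A r f :=
  iSup_congr fun n => congrArg ENNReal.ofReal (S.levelEnergy_sub_const hA r n f c)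

theorem energy_comp_ψ_le (hA : IsLaplacian A) (hr : ∀ i, 0 < r i) (f : C(F, ℝ)) (i : Fin M) :
    S.energy A r (f.comp ⟨S.ψ i, S.continuous_ψ i⟩)
      ≤ ENNReal.ofReal (r i) * S.energy A r f := by
  refine iSup_le fun n => ?_
  calc ENNReal.ofReal (S.levelEnergy A r n (f ∘ S.ψ i))
      ≤ ENNReal.ofReal (r i * S.levelEnergy A r (n + 1) f) :=
        ENNReal.ofReal_le_ofReal (S.levelEnergy_comp_ψ_le hA hr n f i)
    _ = ENNReal.ofReal (r i) * ENNReal.ofReal (S.levelEnergy A r (n + 1) f) :=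
        ENNReal.ofReal_mul (hr i).le
    _ ≤ ENNReal.ofReal (r i) * S.energy A r f := by
        gcongr
        exact le_iSup (fun n => ENNReal.ofReal (S.levelEnergy A r n f)) (n + 1)

end Energy

section EnergyDist

/-- The distance `sup {|f x - f y| : 𝓔(f,f) ≤ 1}`, which is the square root of the resistance
(`resistance_eq_energyDist_sq`). -/
noncomputable def energyDist (A : Matrix S.boundary S.boundary ℝ) (r : Fin M → ℝ) (x y : F) :
    ℝ≥0∞ :=
  ⨆ f : {f : C(F, ℝ) // S.energy A r f ≤ 1}, edist (f.1 x) (f.1 y)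

variable {S}

theorem energyDist_self (x : F) : S.energyDist A r x x = 0 := by
  simp [energyDist]

theorem energyDist_comm (x y : F) : S.energyDist A r x y = S.energyDist A r y x := by
  simp only [energyDist, edist_comm]

theorem energyDist_le_iff {x y : F} {c : ℝ≥0∞} :
    S.energyDist A r x y ≤ c ↔
      ∀ f : C(F, ℝ), S.energy A r f ≤ 1 → edist (f x) (f y) ≤ c :=
  iSup_le_iff.trans Subtype.forall

theorem energyDist_triangle (x y z : F) :
    S.energyDist A r x z ≤ S.energyDist A r x y + S.energyDist A r y z :=
  energyDist_le_iff.2 fun f hf => (edist_triangle _ (f y) _).trans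
    (add_le_add (energyDist_le_iff.1 le_rfl f hf) (energyDist_le_iff.1 le_rfl f hf))

theorem energyDist_ne_top_trans {x y z : F} (hxy : S.energyDist A r x y ≠ ⊤)
    (hyz : S.energyDist A r y z ≠ ⊤) : S.energyDist A r x z ≠ ⊤ :=
  ne_top_of_le_ne_top (ENNReal.add_ne_top.2 ⟨hxy, hyz⟩) (energyDist_triangle x y z)

theorem isClosed_setOf_energyDist_le (x : F) (c : ℝ≥0∞) :
    IsClosed {y | S.energyDist A r x y ≤ c} := by
  simp only [energyDist_le_iff, ofPred_forall]
  exact isClosed_iInter fun f => isClosed_iInter fun _ =>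
    isClosed_le (by fun_prop) continuous_const

theorem edist_le_mul_energyDist {f : C(F, ℝ)} {e : ℝ≥0} (he : 0 < e)
    (hf : S.energy A r f ≤ e ^ 2) (x y : F) : edist (f x) (f y) ≤ e * S.energyDist A r x y := by
  have he' : (e : ℝ≥0∞) ≠ 0 := ENNReal.coe_ne_zero.2 he.ne'
  have hscaled : S.energy A r ((e⁻¹ : ℝ) • f) ≤ 1 := by
    calc S.energy A r ((e⁻¹ : ℝ) • f) = ((e : ℝ≥0∞)⁻¹) ^ 2 * S.energy A r f := by
          rw [energy_smul, ENNReal.ofReal_pow (by positivity),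
            ENNReal.ofReal_inv_of_pos (by exact_mod_cast he), ENNReal.ofReal_coe_nnreal]
      _ ≤ ((e : ℝ≥0∞)⁻¹) ^ 2 * e ^ 2 := by gcongr
      _ = 1 := by rw [← mul_pow, ENNReal.inv_mul_cancel he' ENNReal.coe_ne_top, one_pow]
  have h := energyDist_le_iff.1 (le_refl (S.energyDist A r x y)) _ hscaled
  rwa [ContinuousMap.smul_apply, ContinuousMap.smul_apply, edist_smul₀, nnnorm_inv,
    NNReal.nnnorm_eq, ENNReal.smul_def, ENNReal.coe_inv he.ne', smul_eq_mul,
    ENNReal.inv_mul_le_iff he' ENNReal.coe_ne_top] at h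

theorem energyDist_sq_le_resistance (hA : IsLaplacian A) (x y : F) :
    S.energyDist A r x y ^ 2 ≤ S.resistance A r x y := by
  rw [energyDist, ENNReal.iSup_pow_of_ne_zero two_ne_zero]
  refine iSup_le fun ⟨f, hf⟩ => ?_
  rcases eq_or_ne (f x) (f y) with hxy | hxy
  · simp [hxy]
  set δ := f y - f x
  have hδ : δ ≠ 0 := sub_ne_zero.2 hxy.symm
  let g : C(F, ℝ) := δ⁻¹ • (f - .const F (f x))
  have hg : S.energy A r g ≤ (ENNReal.ofReal (δ ^ 2))⁻¹ := by
    rw [energy_smul, S.energy_sub_const hA, inv_pow, ENNReal.ofReal_inv_of_pos (by positivity)]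
    exact mul_le_of_le_one_right zero_le hf
  have hgxy : g x = 0 ∧ g y = 1 := ⟨by simp [g], inv_mul_cancel₀ hδ⟩
  have hgfin : S.energy A r g < ∞ :=
    hg.trans_lt (ENNReal.inv_lt_top.2 (ENNReal.ofReal_pos.2 (by positivity)))
  calc edist (f x) (f y) ^ 2 = ENNReal.ofReal (δ ^ 2) := by
        rw [edist_comm, edist_dist, Real.dist_eq, ← ENNReal.ofReal_pow (abs_nonneg _), sq_abs]
    _ ≤ (S.energy A r g)⁻¹ := ENNReal.le_inv_iff_le_inv.2 hg
    _ ≤ S.resistance A r x y := ENNReal.inv_le_inv.2 (iInf₂_le g ⟨hgfin, hgxy⟩)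

theorem resistance_le_energyDist_sq (x y : F) :
    S.resistance A r x y ≤ S.energyDist A r x y ^ 2 := by
  rw [resistance, ENNReal.inv_le_iff_inv_le]
  refine le_iInf₂ fun f ⟨_, hx, hy⟩ => le_of_forall_gt_imp_ge_of_dense fun a hfa => ?_
  induction a with
  | top => exact le_top
  | coe a =>
    have ha : 0 < a := ENNReal.coe_pos.1 (zero_le.trans_lt hfa)
    have hle := edist_le_mul_energyDist (NNReal.sqrt_pos.2 ha) (by
      rw [← ENNReal.coe_pow, NNReal.sq_sqrt]; exact hfa.le) x y
    have hone : 1 ≤ (a : ℝ≥0∞) * S.energyDist A r x y ^ 2 := by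
      calc (1 : ℝ≥0∞) = edist (f x) (f y) ^ 2 := by simp [hx, hy, edist_dist]
        _ ≤ (NNReal.sqrt a * S.energyDist A r x y) ^ 2 := by gcongr
        _ = a * S.energyDist A r x y ^ 2 := by
          rw [mul_pow, ← ENNReal.coe_pow, NNReal.sq_sqrt]
    rwa [ENNReal.inv_le_iff_le_mul (fun h => absurd h ENNReal.coe_ne_top)
      (fun _ => ENNReal.coe_ne_zero.2 ha.ne'), mul_comm]

theorem resistance_eq_energyDist_sq (hA : IsLaplacian A) (x y : F) :
    S.resistance A r x y = S.energyDist A r x y ^ 2 :=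
  (resistance_le_energyDist_sq x y).antisymm (energyDist_sq_le_resistance hA x y)

theorem resistance_rpow (hA : IsLaplacian A) (x y : F) (q : ℝ) :
    S.resistance A r x y ^ q = S.energyDist A r x y ^ (2 * q) := by
  rw [resistance_eq_energyDist_sq hA, ENNReal.rpow_mul, ENNReal.rpow_two]

theorem energyDist_ψ_le (hA : IsLaplacian A) (hr : ∀ i, 0 < r i) (i : Fin M) (x y : F) :
    S.energyDist A r (S.ψ i x) (S.ψ i y)
      ≤ NNReal.sqrt (r i).toNNReal * S.energyDist A r x y := by
  refine energyDist_le_iff.2 fun f hf => ?_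
  refine edist_le_mul_energyDist (f := f.comp ⟨S.ψ i, S.continuous_ψ i⟩)
    (NNReal.sqrt_pos.2 (Real.toNNReal_pos.2 (hr i))) ?_ x y
  calc S.energy A r (f.comp ⟨S.ψ i, S.continuous_ψ i⟩) ≤ ENNReal.ofReal (r i) * S.energy A r f :=
        S.energy_comp_ψ_le hA hr f i
    _ ≤ ENNReal.ofReal (r i) * 1 := by gcongr
    _ = (NNReal.sqrt (r i).toNNReal : ℝ≥0∞) ^ 2 := by
        rw [mul_one, ← ENNReal.coe_pow, NNReal.sq_sqrt, ENNReal.ofReal]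

end EnergyDist

section Boundedness

variable {S}

theorem energyDist_ne_top_of_pos (hA : IsLaplacian A) {p q : S.boundary} (hpq : 0 < A p q) :
    S.energyDist A r p q ≠ ⊤ := by
  refine ne_top_of_le_ne_top (b := ENNReal.ofReal √(2 / A p q)) ENNReal.ofReal_ne_top ?_
  refine energyDist_le_iff.2 fun f hf => ?_
  have hlevel : S.levelEnergy A r 0 f ≤ 1 :=
    ENNReal.ofReal_le_one.1 ((le_iSup (fun n => ENNReal.ofReal (S.levelEnergy A r n f)) 0).trans hf)
  rw [S.levelEnergy_zero] at hlevel
  have hsq : A p q * (f p - f q) ^ 2 ≤ 2 * 1 :=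
    (hA.mul_sq_sub_le (fun a : S.boundary => f a) p q).trans
      (mul_le_mul_of_nonneg_left hlevel two_pos.le)
  rw [edist_dist, Real.dist_eq]
  refine ENNReal.ofReal_le_ofReal (Real.abs_le_sqrt ?_)
  rw [le_div_iff₀ hpq]
  linarith

theorem energyDist_boundary_ne_top (hA : IsLaplacian A) (p q : S.boundary) :
    S.energyDist A r p q ≠ ⊤ := by
  induction hA.reflTransGen_pos p q with
  | refl => exact (energyDist_self _).trans_ne ENNReal.zero_ne_top
  | tail _ hpos ih => exact energyDist_ne_top_trans ih (energyDist_ne_top_of_pos hA hpos)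

theorem energyDist_ψ_boundary_ne_top (hA : IsLaplacian A) (hr : ∀ i, 0 < r i) (i : Fin M)
    (p q : S.boundary) : S.energyDist A r (S.ψ i p) (S.ψ i q) ≠ ⊤ :=
  ne_top_of_le_ne_top (ENNReal.mul_ne_top ENNReal.coe_ne_top (energyDist_boundary_ne_top hA p q))
    (energyDist_ψ_le hA hr i p q)

theorem energyDist_ψ_ψ_ne_top (hA : IsLaplacian A) (hr : ∀ i, 0 < r i) (i j : Fin M)
    (p : S.boundary) : S.energyDist A r (S.ψ i p) (S.ψ j p) ≠ ⊤ := by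
  let I : Set (Fin M) := {j | S.energyDist A r (S.ψ i p) (S.ψ j p) ≠ ⊤}
  have hi : i ∈ I := (energyDist_self _).trans_ne ENNReal.zero_ne_top
  by_contra hj
  have hj : j ∈ Iᶜ := not_not_intro hj
  obtain ⟨a, ha, b, hb, x, hx, y, hy, hxy⟩ := S.exists_boundary_link ⟨i, hi⟩ ⟨j, hj⟩
  have hax : S.energyDist A r (S.ψ i p) (S.ψ a x) ≠ ⊤ :=
    energyDist_ne_top_trans ha (energyDist_ψ_boundary_ne_top hA hr a p ⟨x, hx⟩)
  exact hb (energyDist_ne_top_trans (hxy ▸ hax) (energyDist_ψ_boundary_ne_top hA hr b ⟨y, hy⟩ p))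

theorem energyDist_ψ_self_ne_top (hA : IsLaplacian A) (hr : ∀ i, 0 < r i) (i : Fin M)
    (p : S.boundary) : S.energyDist A r (S.ψ i p) p ≠ ⊤ := by
  obtain ⟨j, q, hq, hqp⟩ := S.exists_ψ_eq_of_mem_boundary p.2
  have h := energyDist_ψ_boundary_ne_top hA hr j p ⟨q, hq⟩
  rw [hqp] at h
  exact energyDist_ne_top_trans (energyDist_ψ_ψ_ne_top hA hr i j p) h

theorem energyDist_wordMap_le {K σ : ℝ≥0} (hσ : σ < 1) {p : F}
    (hψ : ∀ i x y, S.energyDist A r (S.ψ i x) (S.ψ i y) ≤ σ * S.energyDist A r x y)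
    (hK : ∀ i, S.energyDist A r (S.ψ i p) p ≤ K) (w : List (Fin M)) :
    S.energyDist A r (S.wordMap w p) p ≤ (K / (1 - σ) : ℝ≥0) := by
  induction w with
  | nil => exact (energyDist_self p).trans_le zero_le
  | cons i w ih =>
    have hfix : σ * (K / (1 - σ)) + K = K / (1 - σ) := by
      have h1σ : 1 - σ ≠ 0 := (tsub_pos_of_lt hσ).ne'
      field_simp
      rw [add_comm, tsub_add_cancel_of_le hσ.le, mul_one]
    calc S.energyDist A r (S.ψ i (S.wordMap w p)) p
        ≤ S.energyDist A r (S.ψ i (S.wordMap w p)) (S.ψ i p) + S.energyDist A r (S.ψ i p) p :=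
          energyDist_triangle _ _ _
      _ ≤ σ * (K / (1 - σ) : ℝ≥0) + K := add_le_add ((hψ i _ _).trans (by gcongr)) (hK i)
      _ = (K / (1 - σ) : ℝ≥0) := by exact_mod_cast hfix

theorem exists_energyDist_le (hA : IsLaplacian A) (hr : ∀ i, 0 < r i) (hr1 : ∀ i, r i < 1) :
    ∃ D : ℝ≥0, ∀ x y, S.energyDist A r x y ≤ D := by
  obtain ⟨p, hp⟩ := S.boundary_nonempty
  let K (i : Fin M) : ℝ≥0 := (S.energyDist A r (S.ψ i p) p).toNNReal
  have hK (i : Fin M) : S.energyDist A r (S.ψ i p) p = K i :=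
    (ENNReal.coe_toNNReal (energyDist_ψ_self_ne_top hA hr i ⟨p, hp⟩)).symm
  set σ : ℝ≥0 := Finset.univ.sup fun i => NNReal.sqrt (r i).toNNReal
  have hσ : σ < 1 := (Finset.sup_lt_iff one_pos).2 fun i _ =>
    (NNReal.sqrt_lt_sqrt.2 (Real.toNNReal_lt_one.2 (hr1 i))).trans_eq NNReal.sqrt_one
  have hψ (i : Fin M) (x y : F) :
      S.energyDist A r (S.ψ i x) (S.ψ i y) ≤ σ * S.energyDist A r x y :=
    (energyDist_ψ_le hA hr i x y).trans (by
      gcongr; exact Finset.le_sup (f := fun i => NNReal.sqrt (r i).toNNReal) (Finset.mem_univ i))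
  set D : ℝ≥0 := Finset.univ.sup K / (1 - σ)
  have horbit (w : List (Fin M)) : S.energyDist A r p (S.wordMap w p) ≤ D := by
    rw [energyDist_comm]
    refine energyDist_wordMap_le hσ hψ (fun i => (hK i).trans_le ?_) w
    exact_mod_cast Finset.le_sup (Finset.mem_univ i)
  have hDp (x : F) : S.energyDist A r p x ≤ D :=
    closure_minimal (t := {x | S.energyDist A r p x ≤ D}) (range_subset_iff.2 horbit)
      (isClosed_setOf_energyDist_le p D) (S.dense_range_wordMap p x)
  refine ⟨D + D, fun x y => (energyDist_triangle x p y).trans ?_⟩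
  rw [energyDist_comm, ENNReal.coe_add]
  exact add_le_add (hDp x) (hDp y)

end Boundedness

section Continuity

open KolmogorovChaining ProbabilityTheory

variable {S}

/-- The set `F` as a pseudoemetric space with the distance `energyDist`, for the application of
the covering number and chaining estimates. -/
@[nolint unusedArguments]
def EnergySpace (S : PCFSelfSimilarSet F M) (_ : Matrix S.boundary S.boundary ℝ)
    (_ : Fin M → ℝ) : Type _ := F

noncomputable instance : PseudoEMetricSpace (S.EnergySpace A r) where
  edist := S.energyDist A r
  edist_self := energyDist_self (F := F)
  edist_comm := energyDist_comm (F := F)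
  edist_triangle := energyDist_triangle (F := F)

theorem exists_hasPolynomialCovering_energySpace (hA : IsLaplacian A) (hr : ∀ i, 0 < r i)
    (hr1 : ∀ i, r i < 1) {d : ℝ} (hd : 0 ≤ d) (hsum : ∑ i, r i ^ d = 1) :
    ∃ D c : ℝ≥0, HasPolynomialCovering (S.EnergySpace A r) D c (2 * d) := by
  obtain ⟨D, hD⟩ := exists_energyDist_le hA hr hr1
  let ψ (i : Fin M) : S.EnergySpace A r → S.EnergySpace A r := (S.ψ i : F → F)
  have hψ (i : Fin M) : LipschitzWith (NNReal.sqrt (r i).toNNReal) (ψ i) := energyDist_ψ_le hA hr i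
  have hcover : ⋃ i, range (ψ i) = univ := S.toSelfSimilarSet.iUnion_range
  refine ⟨D, exists_hasPolynomialCovering_of_iUnion_range hψ hcover
    (fun i => NNReal.sqrt_pos.2 (Real.toNNReal_pos.2 (hr i)))
    (fun i => (NNReal.sqrt_lt_sqrt.2 (Real.toNNReal_lt_one.2 (hr1 i))).trans_eq NNReal.sqrt_one)
    (mul_nonneg two_pos.le hd) ?_ hD⟩
  rw [← NNReal.coe_inj, NNReal.coe_sum, NNReal.coe_one, ← hsum]
  refine Finset.sum_congr rfl fun i _ => ?_
  rw [NNReal.coe_rpow, Real.coe_sqrt, Real.coe_toNNReal _ (hr i).le, Real.rpow_mul (by positivity),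
    Real.rpow_two, Real.sq_sqrt (hr i).le]

theorem isKolmogorovProcess_energySpace {E : Type*} [EMetricSpace E] [SecondCountableTopology E]
    [MeasurableSpace E] [BorelSpace E] {Ω : Type*} [MeasurableSpace Ω] {P : Measure Ω}
    {ξ : F → Ω → E} (hA : IsLaplacian A) (hξ : ∀ x, Measurable (ξ x)) {C : ℝ≥0} {β q : ℝ}
    (hβ : 0 < β) (hq : 0 < q)
    (hmoment : ∀ x y, ∫⁻ ω, edist (ξ x ω) (ξ y ω) ^ β ∂P ≤ C * S.resistance A r x y ^ q) :
    IsKolmogorovProcess (T := S.EnergySpace A r) ξ P β (2 * q) C := by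
  have hmoment' (x y : F) :
      ∫⁻ ω, edist (ξ x ω) (ξ y ω) ^ β ∂P ≤ C * S.energyDist A r x y ^ (2 * q) := by
    rw [← resistance_rpow hA]
    exact hmoment x y
  exact .mk_of_secondCountableTopology hξ hmoment' hβ (mul_pos two_pos hq)

theorem essentiallyHolder_resistance {E : Type*} [PseudoEMetricSpace E] (hA : IsLaplacian A)
    {δ : ℝ} {f : F → E} (hf : EssentiallyHolder (S.energyDist A r) (2 * δ) f) :
    EssentiallyHolder (S.resistance A r) δ f := by
  intro θ hθ hθδ
  obtain ⟨K, hK⟩ := hf (2 * θ) (mul_pos two_pos hθ) (by linarith)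
  exact ⟨K, fun x y => (hK x y).trans_eq (by rw [resistance_rpow hA])⟩

end Continuity

end PCFSelfSimilarSet

end PCF

open PCF.PCFSelfSimilarSet in
theorem mainTheorem6_general
    {F : Type*} [MetricSpace F] [CompactSpace F] [ConnectedSpace F] {M : ℕ}
    (S : PCF.PCFSelfSimilarSet F M) {A : Matrix S.boundary S.boundary ℝ} {r : Fin M → ℝ} {d : ℝ}
    (hA : PCF.IsLaplacian A) (hr : ∀ i, 0 < r i) (hr1 : ∀ i, r i < 1) (hd : 0 < d)
    (hsum : ∑ i, r i ^ d = 1)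
    {E : Type*} [EMetricSpace E] [CompleteSpace E] [TopologicalSpace.SeparableSpace E]
    [MeasurableSpace E] [BorelSpace E]
    {Ω : Type*} [MeasurableSpace Ω] (P : Measure Ω)
    (ξ : F → Ω → E) (hξ : ∀ x, Measurable (ξ x))
    {C : ℝ≥0} {β γ : ℝ} (hβ : 0 < β) (hγ : 0 < γ)
    (hmoment : ∀ x y, ∫⁻ ω, edist (ξ x ω) (ξ y ω) ^ β ∂P ≤ C * S.resistance A r x y ^ (d + γ)) :
    ∃ η : F → Ω → E, (∀ x, Measurable (η x)) ∧ (∀ x, η x =ᵐ[P] ξ x) ∧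
      ∀ᵐ ω ∂P, PCF.EssentiallyHolder (S.resistance A r) (γ / β) (fun x => η x ω) := by
  have : SecondCountableTopology E := UniformSpace.secondCountable_of_separable E
  obtain ⟨D, c, hcovering⟩ := exists_hasPolynomialCovering_energySpace hA hr hr1 hd.le hsum
  have hprocess := isKolmogorovProcess_energySpace hA hξ hβ (by positivity) hmoment
  obtain ⟨η, hη, hηξ, hholder⟩ :=
    hcovering.exists_essentiallyHolder_modification hprocess (by linarith)
  refine ⟨η, hη, hηξ, hholder.mono fun ω hω => essentiallyHolder_resistance hA ?_⟩
  rwa [show 2 * (γ / β) = (2 * (d + γ) - 2 * d) / β by ring]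

theorem mainTheorem6
    {F : Type*} [MetricSpace F] [CompactSpace F] [ConnectedSpace F] {M : ℕ}
    (S : PCF.PCFSelfSimilarSet F M) (H : PCF.RegularHarmonicStructure S)
    {E : Type*} [MetricSpace E] [CompleteSpace E] [TopologicalSpace.SeparableSpace E]
    [MeasurableSpace E] [BorelSpace E]
    {Ω : Type*} [MeasurableSpace Ω] (P : Measure Ω) [IsProbabilityMeasure P]
    (ξ : F → Ω → E) (hξ : ∀ x, Measurable (ξ x))
    (C β γ : ℝ) (hC : 0 < C) (hβ : 0 < β) (hγ : 0 < γ)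
    (hmoment : ∀ x y, ∫⁻ ω, edist (ξ x ω) (ξ y ω) ^ β ∂P
      ≤ ENNReal.ofReal C * H.resistance x y ^ (H.dH + γ)) :
    ∃ η : F → Ω → E, (∀ x, Measurable (η x)) ∧ (∀ x, η x =ᵐ[P] ξ x) ∧
      ∀ᵐ ω ∂P, PCF.EssentiallyHolder H.resistance (γ / β) (fun x => η x ω) :=
  have ⟨hd, hsum⟩ := H.existsUnique_dim.choose_spec.1
  mainTheorem6_general S H.isLaplacian H.r_pos H.r_lt_one hd hsum P ξ hξ hβ hγ hmoment
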